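/- Let $K$ be a field of characteristic $0$ and let $t_1,t_2,\dots$ be variables. Define polynomials $\mathbf s_k(t)\in K[t_1,t_2,\dots]$ by $\exp\bigl(\sum_{i\ge1}t_iz^i\bigr)=\sum_{k\ge0}\mathbf s_k(t)z^k$ and $\mathbf s_k=0$ for $k<0$; for a partition $\lambda=(\lambda_1\ge\dots\ge\lambda_\ell>0)$ let $\mathbf s_\lambda(t)=\det\bigl(\mathbf s_{\lambda_i-i+j}(t)\bigr)_{1\le i,j\le\ell}$ be its Schur polynomial. For $k\in\mathbb Z$ let $$V_k=\frac12\sum_{i+j=k}\frac{\partial^2}{\partial t_i\,\partial t_j}+\sum_{-i+j=k}i\,t_i\frac{\partial}{\partial t_j}+\frac12\sum_{-i-j=k}(i\,t_i)(j\,t_j)\qquad(i,j\ge1)$$ act on $K[t_1,t_2,\dots]$. For partitions $\mu\subseteq\lambda$ write $\lambda\backslash\mu\in B(i)$ if the skew shape $\lambda\backslash\mu$ is a border strip of size $i$, that is, a nonempty connected set of exactly $i$ boxes containing no $2\times2$ square (so $B(0)=\emptyset$); its height $\mathrm{ht}$ is the number of rows that it meets, minus one. Theorem 5.1. For every $n\ge1$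 and every partition $\lambda$, $$V_{-n}\,\mathbf s_\lambda=\sum_{\mu:\ \mu\backslash\lambda\in B(n)}d^{(-n)}_{\lambda\mu}\,\mathbf s_\mu,\qquad V_{n}\,\mathbf s_\lambda=\sum_{\mu:\ \lambda\backslash\mu\in B(n)}d^{(-n)}_{\mu\lambda}\,\mathbf s_\mu,$$ where both sums are finite and $$d^{(-n)}_{\lambda\mu}=\sum_{i\ge1}\ \sum_{\substack{\nu:\ \lambda\backslash\nu\in B(i),\ \mu\backslash\nu\in B(n+i),\\ \lambda\backslash\nu\subset\mu\backslash\nu}}(-1)^{\mathrm{ht}(\lambda\backslash\nu)+\mathrm{ht}(\mu\backslash\nu)}+\frac12\sum_{i=1}^{n}\ \sum_{\substack{\nu:\ \nu\backslash\lambda\in B(i),\\ \mu\backslash\nu\in B(n-i)}}(-1)^{\mathrm{ht}(\nu\backslash\lambda)+\mathrm{ht}(\mu\backslash\nu)}.$$ These are the same index sets (the same band structure) as for multiplication by $nt_n$ and for $\partial/\partial t_n$: $$n\,t_n\,\mathbf s_\lambda=\sum_{\mu:\ \mu\backslash\lambda\in B(n)}(-1)^{\mathrm{ht}(\mu\backslash\lambda)}\mathbf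 s_\mu,\qquad\frac{\partial}{\partial t_n}\mathbf s_\lambda=\sum_{\mu:\ \lambda\backslash\mu\in B(n)}(-1)^{\mathrm{ht}(\lambda\backslash\mu)}\mathbf s_\mu.$$ -/

import Mathlib

noncomputable section

namespace VirasoroSchur

/-- Polynomials over `K` in the infinitely many variables `t₁, t₂, t₃, …`
(`t_i` is `MvPolynomial.X i`, with `i : ℕ+`). -/
abbrev TPoly (K : Type*) [Field K] : Type _ := MvPolynomial ℕ+ K

/-! ### Schur polynomials in the variables `t` -/

/-- The power series `∑_{i ≥ 1} t_i z^i` in the variable `z`. -/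
def tSeries (K : Type*) [Field K] : PowerSeries (TPoly K) :=
  PowerSeries.mk fun i => if h : 0 < i then MvPolynomial.X (⟨i, h⟩ : ℕ+) else 0

/-- The substitution of `∑_{i ≥ 1} t_i z^i` into a formal power series is legitimate. -/
theorem hasSubst_tSeries (K : Type*) [Field K] : PowerSeries.HasSubst (tSeries K) := by
  apply PowerSeries.HasSubst.of_constantCoeff_zero'
  rw [← PowerSeries.coeff_zero_eq_constantCoeff_apply]
  simp [tSeries]

/-- The elementary Schur polynomials `s_k(t)`, `k ∈ ℤ`, defined by
`exp (∑_{i ≥ 1} t_i z^i) = ∑_{k ≥ 0} s_k(t) z^k`, and `s_k(t) = 0` for `k < 0`. -/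
def elemSchur (K : Type*) [Field K] [CharZero K] (k : ℤ) : TPoly K :=
  if 0 ≤ k then
    PowerSeries.coeff k.toNat ((PowerSeries.exp (TPoly K)).subst (tSeries K))
  else 0

/-- The Schur polynomial `s_lam(t) = det (s_{lam_i - i + j}(t))_{1 ≤ i, j ≤ ℓ}` of the partition
`lam`, where `ℓ = lam.colLen 0` is its number of rows and `lam_i` the length of its `i`-th row. -/
def schur (K : Type*) [Field K] [CharZero K] (lam : YoungDiagram) : TPoly K :=
  Matrix.det (Matrix.of fun i j : Fin (lam.colLen 0) =>
    elemSchur K ((lam.rowLen i : ℤ) - (i : ℤ) + (j : ℤ)))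

/-! ### The Virasoro operators -/

/-- The Virasoro operator, for `k ∈ ℤ` (all indices `i, j` run over the integers `≥ 1`),
`V_k = (1/2) ∑_{i+j=k} ∂²/∂t_i∂t_j + ∑_{-i+j=k} i t_i ∂/∂t_j + (1/2) ∑_{-i-j=k} (i t_i)(j t_j)`.
On a given polynomial only finitely many terms are nonzero, see `finite_index_left`,
`finite_support_middle` and `finite_index_right`. -/
def virasoro {K : Type*} [Field K] (k : ℤ) (f : TPoly K) : TPoly K :=
  (1 / 2 : K) • (∑ᶠ p ∈ {p : ℕ+ × ℕ+ | ((p.1 : ℕ) : ℤ) + ((p.2 : ℕ) : ℤ) = k},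
      MvPolynomial.pderiv p.1 (MvPolynomial.pderiv p.2 f))
  + (∑ᶠ p ∈ {p : ℕ+ × ℕ+ | -((p.1 : ℕ) : ℤ) + ((p.2 : ℕ) : ℤ) = k},
      (((p.1 : ℕ) : K) • MvPolynomial.X p.1) * MvPolynomial.pderiv p.2 f)
  + (1 / 2 : K) • (∑ᶠ p ∈ {p : ℕ+ × ℕ+ | -((p.1 : ℕ) : ℤ) - ((p.2 : ℕ) : ℤ) = k},
      (((p.1 : ℕ) : K) • MvPolynomial.X p.1) * ((((p.2 : ℕ) : K) • MvPolynomial.X p.2) * f))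

theorem finite_index_left (k : ℤ) :
    {p : ℕ+ × ℕ+ | ((p.1 : ℕ) : ℤ) + ((p.2 : ℕ) : ℤ) = k}.Finite := by
  refine Set.Finite.of_finite_image
    (f := fun p : ℕ+ × ℕ+ => ((p.1 : ℕ), (p.2 : ℕ))) ?_ ?_
  · refine ((Set.finite_Iic k.toNat).prod (Set.finite_Iic k.toNat)).subset ?_
    rintro _ ⟨p, hp, rfl⟩
    simp only [Set.mem_ofPred_eq] at hp
    simp only [Set.mem_prod, Set.mem_Iic]
    omega
  · rintro ⟨a, b⟩ _ ⟨c, d⟩ _ h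
    simpa [Prod.ext_iff] using h

theorem finite_index_right (k : ℤ) :
    {p : ℕ+ × ℕ+ | -((p.1 : ℕ) : ℤ) - ((p.2 : ℕ) : ℤ) = k}.Finite := by
  refine (finite_index_left (-k)).subset ?_
  intro p hp
  simp only [Set.mem_ofPred_eq] at hp ⊢
  omega

theorem finite_support_middle {K : Type*} [Field K] (k : ℤ) (f : TPoly K) :
    ({p : ℕ+ × ℕ+ | -((p.1 : ℕ) : ℤ) + ((p.2 : ℕ) : ℤ) = k} ∩
      Function.support fun p : ℕ+ × ℕ+ =>
        (((p.1 : ℕ) : K) • (MvPolynomial.X p.1 : TPoly K)) *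
          MvPolynomial.pderiv p.2 f).Finite := by
  refine Set.Finite.of_finite_image (f := fun p : ℕ+ × ℕ+ => p.2) ?_ ?_
  · refine f.vars.finite_toSet.subset ?_
    rintro _ ⟨p, hp, rfl⟩
    by_contra h
    exact hp.2 (by simp [MvPolynomial.pderiv_eq_zero_of_notMem_vars h])
  · rintro ⟨a, b⟩ h ⟨c, d⟩ h' hbd
    have h1 := h.1
    have h2 := h'.1
    simp only [Set.mem_ofPred_eq] at h1 h2 hbd
    subst hbd
    refine Prod.ext (PNat.eq ?_) rfl
    simp only
    omega

/-! ### Border strips -/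

/-- The boxes of the skew shape `lam \ mu`. -/
def skewCells (lam mu : YoungDiagram) : Finset (ℕ × ℕ) := lam.cells \ mu.cells

/-- `IsBorderStrip lam mu i` says that `lam \ mu ∈ B(i)`: `mu ⊆ lam`, and the skew shape `lam \ mu`
has exactly `i` boxes, is connected (in the graph on `ℕ × ℕ` in which two boxes are adjacent
when they share an edge; a connected shape is nonempty, so that `B(0) = ∅`), and contains no
`2 × 2` square. -/
def IsBorderStrip (lam mu : YoungDiagram) (i : ℕ) : Prop :=
  mu ≤ lam ∧ (skewCells lam mu).card = i ∧
  ((SimpleGraph.hasse (ℕ × ℕ)).induce (skewCells lam mu : Set (ℕ × ℕ))).Connected ∧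
  ∀ r c : ℕ, ¬ ((r, c) ∈ skewCells lam mu ∧ (r, c + 1) ∈ skewCells lam mu ∧
    (r + 1, c) ∈ skewCells lam mu ∧ (r + 1, c + 1) ∈ skewCells lam mu)

/-- Adjacency in the graph used in `IsBorderStrip` means sharing an edge. -/
theorem hasse_adj_iff (a b : ℕ × ℕ) : (SimpleGraph.hasse (ℕ × ℕ)).Adj a b ↔
    (a.1 = b.1 ∧ (a.2 + 1 = b.2 ∨ b.2 + 1 = a.2)) ∨
    (a.2 = b.2 ∧ (a.1 + 1 = b.1 ∨ b.1 + 1 = a.1)) := by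
  obtain ⟨a1, a2⟩ := a
  obtain ⟨b1, b2⟩ := b
  simp only [SimpleGraph.hasse_adj, Prod.mk_covBy_mk_iff, Nat.covBy_iff_add_one_eq]
  omega

/-- The height of the strip `lam \ mu`: the number of rows that it meets, minus one. -/
def ht (lam mu : YoungDiagram) : ℕ := ((skewCells lam mu).image Prod.fst).card - 1

theorem finite_le (lam : YoungDiagram) : {nu : YoungDiagram | nu ≤ lam}.Finite := by
  refine Set.Finite.of_finite_image (f := YoungDiagram.cells) ?_ ?_
  · refine lam.cells.powerset.finite_toSet.subset ?_
    rintro _ ⟨nu, h, rfl⟩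
    simpa using h
  · intro a _ b _ h
    exact YoungDiagram.ext h

/-- The coefficient `d^{(-n)}_{lam mu}`:
`∑_{i ≥ 1} ∑_{nu} (-1)^{ht (lam \ nu) + ht (mu \ nu)}` over the partitions `nu` with
`lam \ nu ∈ B(i)`, `mu \ nu ∈ B(n + i)`, `lam \ nu ⊆ mu \ nu`, plus
`(1/2) ∑_{i = 1}^n ∑_{nu} (-1)^{ht (nu \ lam) + ht (mu \ nu)}` over the partitions `nu` with
`nu \ lam ∈ B(i)`, `mu \ nu ∈ B(n - i)`.
All index sets are finite, see `finite_first_outer`, `finite_first_inner`, `finite_second`. -/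
def virasoroCoeff (n : ℕ) (lam mu : YoungDiagram) : ℚ :=
  (∑ᶠ i ∈ {i : ℕ | 1 ≤ i},
    ∑ᶠ nu ∈ {nu : YoungDiagram | IsBorderStrip lam nu i ∧ IsBorderStrip mu nu (n + i) ∧
        skewCells lam nu ⊆ skewCells mu nu},
      (-1 : ℚ) ^ (ht lam nu + ht mu nu))
  + 1 / 2 * ∑ i ∈ Finset.Icc 1 n,
    ∑ᶠ nu ∈ {nu : YoungDiagram | IsBorderStrip nu lam i ∧ IsBorderStrip mu nu (n - i)},
      (-1 : ℚ) ^ (ht nu lam + ht mu nu)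

theorem finite_first_inner (n i : ℕ) (lam mu : YoungDiagram) :
    {nu : YoungDiagram | IsBorderStrip lam nu i ∧ IsBorderStrip mu nu (n + i) ∧
      skewCells lam nu ⊆ skewCells mu nu}.Finite :=
  (finite_le lam).subset fun _ h => h.1.1

theorem finite_first_outer (n : ℕ) (lam mu : YoungDiagram) :
    {i : ℕ | {nu : YoungDiagram | IsBorderStrip lam nu i ∧ IsBorderStrip mu nu (n + i) ∧
      skewCells lam nu ⊆ skewCells mu nu}.Nonempty}.Finite := by
  refine (Set.finite_Iic lam.cells.card).subset ?_
  rintro i ⟨nu, h, -⟩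
  rw [Set.mem_Iic, ← h.2.1]
  exact Finset.card_le_card Finset.sdiff_subset

theorem finite_second (n i : ℕ) (lam mu : YoungDiagram) :
    {nu : YoungDiagram | IsBorderStrip nu lam i ∧ IsBorderStrip mu nu (n - i)}.Finite :=
  (finite_le mu).subset fun _ h => h.2.1

end VirasoroSchur

end

/-!
# Virasoro operators in the basis of Schur polynomials

A partition with at most `N` rows is encoded by the positions of `N` beads, `beads N lam`, and its
Schur polynomial is the Jacobi–Trudi determinant `beadDet`, an alternating function of the bead
positions. Adding a border strip of size `n` means raising one bead by `n` to a free position, and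
the sign `(-1) ^ ht` is the sign of the permutation that sorts the beads afterwards
(`exists_isMove`, `exists_isBorderStrip`). For every alternating function, the sum over all ways of
raising or lowering one bead is therefore a signed sum over border strips (`IsSkew.raise_beads`,
`IsSkew.lower_beads`).

The derivative by `t_n` lowers the rows of a Jacobi–Trudi determinant by `n`, one at a time, since
it lowers the index of every elementary Schur polynomial by `n`. Multiplication by `p_n = n t_n`
raises the rows by `n`, one at a time: raising the rows has the same effect as raising the columns,
in a determinant with `n` redundant rows only the last `n` columns contribute, and they contribute
a factor that is the coefficient of `z^n` in the logarithmic derivative of `∑ s_k z^k`, which is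
`p_n` (`sum_jtDet_rowLen_update`). This gives the rules for `n t_n` and for `∂/∂t_n`.

As `V_{-n} = ∑_j p_{n+j} ∂/∂t_j + (1/2) ∑_r p_{n-r} p_r`, and similarly for `V_n`, composing these
rules expresses `V_{∓n} s_lam` by Schur polynomials, with coefficients that count pairs of border
strips. On the pairs with `mu \ lam ∈ B(n)` these are the coefficients `virasoroCoeff`, the
inclusion `lam \ nu ⊆ mu \ nu` being automatic. What has to be shown is that the other coefficients
vanish. Applied to the alternating function `beadIndicator`, which detects `mu`, the rules turn the
coefficient of `mu` into a sum over moves of two beads. For two different beads that end up at `x`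
and `S - x`, the terms form a sum over an interval of values of `x` and change sign under
`x ↦ S - x`. Everything cancels except for moves of a single bead by `n`
(`two_mul_sum_lower_raise`), so that only the `mu` with `mu \ lam ∈ B(n)` remain.
-/

noncomputable section

namespace VirasoroSchur

open Finset

/-! ### Elementary Schur polynomials -/

section ElementarySchur

variable (K : Type*) [Field K] [CharZero K]

/-- The power sum `p_i = i t_i` for `i ≥ 1`, and `p_0 = 0` (the index of the variable is then the
junk value `1`, with the coefficient `0`). -/
def powerSum (i : ℕ) : TPoly K := (i : K) • (MvPolynomial.X i.toPNat' : TPoly K)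

theorem powerSum_zero : powerSum K 0 = 0 := by simp [powerSum]

/-- The generating series `∑ s_k(t) z^k = exp (∑ t_i z^i)`. -/
def schurSeries : PowerSeries (TPoly K) := (PowerSeries.exp (TPoly K)).subst (tSeries K)

theorem elemSchur_natCast (k : ℕ) : elemSchur K k = PowerSeries.coeff k (schurSeries K) := by
  simp [elemSchur, schurSeries]

theorem elemSchur_of_neg {k : ℤ} (hk : k < 0) : elemSchur K k = 0 := by
  simp [elemSchur, not_le.mpr hk]

theorem X_mul_derivative_schurSeries :
    PowerSeries.X * PowerSeries.derivative (TPoly K) (schurSeries K) =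
      PowerSeries.mk (powerSum K) * schurSeries K := by
  have h : PowerSeries.X * PowerSeries.derivative (TPoly K) (tSeries K) =
      PowerSeries.mk (powerSum K) := by
    ext1 k
    cases k with
    | zero => simp [powerSum]
    | succ k =>
      rw [PowerSeries.coeff_succ_X_mul, PowerSeries.coeff_derivative]
      simp only [tSeries, powerSum, PowerSeries.coeff_mk, Nat.succ_pos, dif_pos,
        MvPolynomial.smul_eq_C_mul, map_natCast]
      push_cast
      exact mul_comm _ _
  rw [schurSeries, PowerSeries.derivative_subst (hasSubst_tSeries K), PowerSeries.derivative_exp,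
    ← h]
  ring

theorem constantCoeff_schurSeries : PowerSeries.constantCoeff (schurSeries K) = 1 := by
  have h0 : PowerSeries.constantCoeff (tSeries K) = 0 := by
    rw [← PowerSeries.coeff_zero_eq_constantCoeff_apply]
    simp [tSeries]
  rw [← PowerSeries.coeff_zero_eq_constantCoeff_apply, schurSeries,
    PowerSeries.coeff_subst' (hasSubst_tSeries K), finsum_eq_single _ 0]
  · simp
  · intro n hn
    simp [h0, hn]

theorem elemSchur_zero : elemSchur K 0 = 1 := by
  rw [← Nat.cast_zero, elemSchur_natCast, PowerSeries.coeff_zero_eq_constantCoeff_apply,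
    constantCoeff_schurSeries]

/-- Newton's identity, the coefficientwise form of the differential equation of `schurSeries`. -/
theorem natCast_mul_elemSchur (k : ℕ) : (k : TPoly K) * elemSchur K k =
    ∑ p ∈ antidiagonal k, powerSum K p.1 * elemSchur K p.2 := by
  have h := congrArg (PowerSeries.coeff k) (X_mul_derivative_schurSeries K)
  rw [PowerSeries.coeff_mul k (PowerSeries.mk _)] at h
  simp only [PowerSeries.coeff_mk, ← elemSchur_natCast] at h
  rw [← h]
  cases k with
  | zero => simp
  | succ k =>
    rw [PowerSeries.coeff_succ_X_mul, PowerSeries.coeff_derivative, ← elemSchur_natCast]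
    push_cast
    ring

theorem pderiv_powerSum (n : ℕ+) (i : ℕ) :
    MvPolynomial.pderiv n (powerSum K i) = if i = n then ((n : ℕ) : TPoly K) else 0 := by
  rw [powerSum, Derivation.map_smul, MvPolynomial.pderiv_X]
  split_ifs with h
  · subst h
    simp [MvPolynomial.smul_eq_C_mul]
  · rcases Nat.eq_zero_or_pos i with rfl | h0
    · simp
    · have : i.toPNat' ≠ n := by
        rintro rfl
        exact h (by simp [h0])
      simp [this]

/-- The derivative by `t_n` of the generating series is its product with `z^n`; coefficientwise,
this follows from Newton's identity by induction. -/
theorem pderiv_elemSchur (n : ℕ+) (k : ℤ) :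
    MvPolynomial.pderiv n (elemSchur K k) = elemSchur K (k - (n : ℕ)) := by
  rcases lt_or_ge k 0 with hk | hk
  · rw [elemSchur_of_neg K hk, elemSchur_of_neg K (by omega), map_zero]
  lift k to ℕ using hk
  induction k using Nat.strong_induction_on with
  | _ k ih =>
    have hn := n.pos
    rcases Nat.eq_zero_or_pos k with rfl | hk
    · rw [Nat.cast_zero, elemSchur_zero, elemSchur_of_neg K (by omega)]
      simp
    have hk0 : (k : TPoly K) ≠ 0 := by exact_mod_cast hk.ne'
    apply mul_left_cancel₀ hk0
    have h := congrArg (MvPolynomial.pderiv n) (natCast_mul_elemSchur K k)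
    rw [Derivation.leibniz, Derivation.map_natCast, smul_zero, add_zero, smul_eq_mul] at h
    rw [h, map_sum]
    simp only [Derivation.leibniz, pderiv_powerSum, smul_eq_mul, sum_add_distrib]
    have h2 : ∑ p ∈ antidiagonal k, powerSum K p.1 *
        MvPolynomial.pderiv n (elemSchur K (p.2 : ℤ)) =
        ∑ p ∈ antidiagonal k, powerSum K p.1 * elemSchur K ((p.2 : ℤ) - (n : ℕ)) := by
      refine sum_congr rfl fun p hp => ?_
      rcases Nat.eq_zero_or_pos p.1 with h0 | h0
      · simp [h0, powerSum_zero]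
      · rw [ih p.2 (by rw [HasAntidiagonal.mem_antidiagonal] at hp; omega)]
    rw [h2]
    rcases lt_or_ge k n with hkn | hkn
    · rw [elemSchur_of_neg K (by omega : (k : ℤ) - (n : ℕ) < 0), mul_zero,
        sum_eq_zero, sum_eq_zero, add_zero]
      · intro p hp
        rw [HasAntidiagonal.mem_antidiagonal] at hp
        rw [if_neg (by omega), mul_zero]
      · intro p hp
        rw [HasAntidiagonal.mem_antidiagonal] at hp
        rw [elemSchur_of_neg K (by omega), mul_zero]
    · obtain ⟨m, rfl⟩ := Nat.exists_eq_add_of_le hkn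
      have e : (((n : ℕ) + m : ℕ) : ℤ) - (n : ℕ) = m := by push_cast; ring
      have h3 : ∑ p ∈ antidiagonal ((n : ℕ) + m),
          powerSum K p.1 * elemSchur K ((p.2 : ℤ) - (n : ℕ)) = (m : TPoly K) * elemSchur K m := by
        rw [natCast_mul_elemSchur]
        symm
        apply sum_of_injOn (fun p : ℕ × ℕ => (p.1, p.2 + n))
        · intro p _ q _ hpq
          simpa [Prod.ext_iff] using hpq
        · intro p hp
          simp only [mem_coe, HasAntidiagonal.mem_antidiagonal] at hp ⊢
          omega
        · intro p hp hp'
          rw [HasAntidiagonal.mem_antidiagonal] at hp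
          rw [elemSchur_of_neg K, mul_zero]
          by_contra hlt
          apply hp'
          refine ⟨(p.1, p.2 - n), ?_, ?_⟩
          · simp only [mem_coe, HasAntidiagonal.mem_antidiagonal]
            omega
          · simp only [Prod.ext_iff, true_and]
            omega
        · intro p _
          push_cast
          rw [add_sub_cancel_right]
      rw [h3, e, sum_eq_single ((n : ℕ), m)]
      · simp only [if_true]
        push_cast
        ring
      · intro p hp hne
        rw [HasAntidiagonal.mem_antidiagonal] at hp
        rw [if_neg, mul_zero]
        intro h
        exact hne (Prod.ext h (by simp only; omega))
      · simp

/-- The coefficients of the inverse of the generating series, which are the elementary symmetric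
functions up to sign, extended by `0` to negative indices. -/
def invSchur (k : ℤ) : TPoly K :=
  if 0 ≤ k then PowerSeries.coeff k.toNat (PowerSeries.invOfUnit (schurSeries K) 1) else 0

theorem invSchur_natCast (k : ℕ) :
    invSchur K k = PowerSeries.coeff k (PowerSeries.invOfUnit (schurSeries K) 1) := by
  simp [invSchur]

theorem invSchur_of_neg {k : ℤ} (hk : k < 0) : invSchur K k = 0 := by
  simp [invSchur, not_le.mpr hk]

theorem schurSeries_mul_inv : schurSeries K * PowerSeries.invOfUnit (schurSeries K) 1 = 1 :=
  PowerSeries.mul_invOfUnit _ _ (by simp [constantCoeff_schurSeries])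

theorem sum_elemSchur_mul_invSchur (k : ℕ) :
    ∑ p ∈ antidiagonal k, elemSchur K p.1 * invSchur K p.2 = if k = 0 then 1 else 0 := by
  have h := congrArg (PowerSeries.coeff k) (schurSeries_mul_inv K)
  rw [PowerSeries.coeff_mul, PowerSeries.coeff_one] at h
  simpa only [elemSchur_natCast, invSchur_natCast] using h

/-- The logarithmic derivative of the generating series has the power sums as coefficients. -/
theorem sum_invSchur_mul_natCast_mul_elemSchur (k : ℕ) :
    ∑ p ∈ antidiagonal k, invSchur K p.1 * ((p.2 : TPoly K) * elemSchur K p.2) = powerSum K k := by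
  have h : PowerSeries.invOfUnit (schurSeries K) 1 *
      (PowerSeries.X * PowerSeries.derivative (TPoly K) (schurSeries K)) =
      PowerSeries.mk (powerSum K) := by
    rw [X_mul_derivative_schurSeries, mul_left_comm, mul_comm _ (schurSeries K),
      schurSeries_mul_inv, mul_one]
  have h := congrArg (PowerSeries.coeff k) h
  rw [PowerSeries.coeff_mul, PowerSeries.coeff_mk] at h
  rw [← h]
  refine sum_congr rfl fun p _ => ?_
  rw [invSchur_natCast]
  congr 1
  generalize p.2 = j
  cases j with
  | zero => simp
  | succ j =>
    rw [PowerSeries.coeff_succ_X_mul, PowerSeries.coeff_derivative, ← elemSchur_natCast]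
    push_cast
    ring

end ElementarySchur

/-! ### Jacobi–Trudi determinants -/

section JacobiTrudi

theorem sum_det_updateRow_eq_sum_det_updateCol {ι R : Type*} [Fintype ι] [DecidableEq ι]
    [CommRing R] (M T : Matrix ι ι R) :
    ∑ i, (M.updateRow i (T i)).det = ∑ j, (M.updateCol j fun i => T i j).det := by
  simp only [← Matrix.cramer_transpose_apply, ← Matrix.cramer_apply,
    Matrix.cramer_eq_adjugate_mulVec, Matrix.mulVec, dotProduct, ← Matrix.adjugate_transpose,
    Matrix.transpose_apply]
  rw [sum_comm]

theorem derivation_prod {R A ι : Type*} [CommSemiring R] [CommRing A] [Algebra R A]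
    [DecidableEq ι] (D : Derivation R A A) (s : Finset ι) (f : ι → A) :
    D (∏ i ∈ s, f i) = ∑ i ∈ s, D (f i) * ∏ j ∈ s.erase i, f j := by
  induction s using Finset.induction_on with
  | empty => simp
  | insert a s ha ih =>
    rw [prod_insert ha, Derivation.leibniz, ih, sum_insert ha, smul_eq_mul, smul_eq_mul,
      add_comm, mul_comm, erase_insert ha, mul_sum]
    congr 1
    refine sum_congr rfl fun i hi => ?_
    have hne : a ≠ i := fun h => ha (h ▸ hi)
    rw [erase_insert_of_ne hne, prod_insert (by simp [ha])]
    ring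

theorem derivation_det {R A ι : Type*} [CommSemiring R] [CommRing A] [Algebra R A]
    [Fintype ι] [DecidableEq ι] (D : Derivation R A A) (M : Matrix ι ι A) :
    D M.det = ∑ j, (M.updateCol j fun i => D (M i j)).det := by
  simp only [Matrix.det_apply]
  rw [map_sum, sum_comm]
  refine sum_congr rfl fun σ _ => ?_
  simp only [Units.smul_def]
  rw [map_zsmul, ← smul_sum, derivation_prod]
  congr 1
  refine sum_congr rfl fun j _ => ?_
  rw [← mul_prod_erase univ _ (mem_univ j), Matrix.updateCol_self]
  congr 1
  refine prod_congr rfl fun k hk => ?_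
  rw [Matrix.updateCol_ne (ne_of_mem_erase hk)]

/-- The determinant of the matrix `s_{x_i + y_j}(t)`. -/
def jtDet (K : Type*) [Field K] [CharZero K] {ι : Type*} [Fintype ι] [DecidableEq ι]
    (x y : ι → ℤ) : TPoly K :=
  (Matrix.of fun i j => elemSchur K (x i + y j)).det

variable {K : Type*} [Field K] [CharZero K] {ι κ : Type*} [Fintype ι] [DecidableEq ι]
  [Fintype κ] [DecidableEq κ]

theorem jtDet_congr {x y x' y' : ι → ℤ} (h : ∀ i j, x i + y j = x' i + y' j) :
    jtDet K x y = jtDet K x' y' := by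
  simp only [jtDet, h]

theorem jtDet_comp_equiv (e : κ ≃ ι) (x y : ι → ℤ) : jtDet K (x ∘ e) (y ∘ e) = jtDet K x y :=
  Matrix.det_submatrix_equiv_self e (Matrix.of fun i j => elemSchur K (x i + y j))

theorem jtDet_comp_perm (σ : Equiv.Perm ι) (x y : ι → ℤ) :
    jtDet K (x ∘ σ) y = ((Equiv.Perm.sign σ : ℤ) : TPoly K) * jtDet K x y :=
  Matrix.det_permute σ (Matrix.of fun i j => elemSchur K (x i + y j))

theorem jtDet_eq_zero_of_neg {x y : ι → ℤ} (i : ι) (h : ∀ j, x i + y j < 0) :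
    jtDet K x y = 0 :=
  Matrix.det_eq_zero_of_row_eq_zero i fun j => elemSchur_of_neg K (h j)

theorem jtDet_eq_zero_of_eq {x y : ι → ℤ} {i j : ι} (hij : i ≠ j) (h : y i = y j) :
    jtDet K x y = 0 :=
  Matrix.det_zero_of_column_eq hij fun k => by simp [h]

theorem jtDet_update_left (x y : ι → ℤ) (c : ℤ) (i : ι) :
    jtDet K (Function.update x i (x i + c)) y =
      ((Matrix.of fun i j => elemSchur K (x i + y j)).updateRow i
        fun j => elemSchur K (x i + y j + c)).det := by
  rw [jtDet]
  congr 1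
  ext1 k j
  rcases eq_or_ne k i with rfl | hk
  · simp [add_right_comm]
  · simp [hk]

theorem jtDet_update_right (x y : ι → ℤ) (c : ℤ) (j : ι) :
    jtDet K x (Function.update y j (y j + c)) =
      ((Matrix.of fun i j => elemSchur K (x i + y j)).updateCol j
        fun i => elemSchur K (x i + y j + c)).det := by
  rw [jtDet]
  congr 1
  ext1 i k
  rcases eq_or_ne k j with rfl | hk
  · simp [add_assoc]
  · simp [hk]

/-- Shifting the rows one at a time has the same effect as shifting the columns one at a time. -/
theorem sum_jtDet_update (x y : ι → ℤ) (c : ℤ) :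
    ∑ i, jtDet K (Function.update x i (x i + c)) y =
      ∑ j, jtDet K x (Function.update y j (y j + c)) := by
  simp only [jtDet_update_left, jtDet_update_right]
  exact sum_det_updateRow_eq_sum_det_updateCol _
    (Matrix.of fun i j => elemSchur K (x i + y j + c))

theorem pderiv_jtDet (n : ℕ+) (x y : ι → ℤ) :
    MvPolynomial.pderiv n (jtDet K x y) =
      ∑ i, jtDet K (Function.update x i (x i + -((n : ℕ) : ℤ))) y := by
  rw [sum_jtDet_update, jtDet, derivation_det]
  refine sum_congr rfl fun j _ => ?_
  simp only [jtDet_update_right, Matrix.of_apply, pderiv_elemSchur]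
  rfl

/-- A block triangular Jacobi–Trudi determinant, with the block of the rows `x₂` and the columns
`y₁` equal to zero. -/
theorem jtDet_sumElim (x₁ y₁ : ι → ℤ) (x₂ y₂ : κ → ℤ) (h : ∀ k i, x₂ k + y₁ i < 0) :
    jtDet K (Sum.elim x₁ x₂) (Sum.elim y₁ y₂) = jtDet K x₁ y₁ * jtDet K x₂ y₂ := by
  rw [jtDet, jtDet, jtDet, ← Matrix.det_fromBlocks_zero₂₁ _
    (Matrix.of fun i k => elemSchur K (x₁ i + y₂ k))]
  congr 1
  ext1 a b
  rcases a with a | a <;> rcases b with b | b <;>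
    simp [elemSchur_of_neg, h]

/-- The rows `-a` and the columns `b` give an upper unitriangular matrix. -/
theorem jtDet_neg_val (n : ℕ) :
    jtDet K (fun a : Fin n => -(a : ℤ)) (fun b => (b : ℤ)) = 1 := by
  rw [jtDet, Matrix.det_of_isUpperTriangular]
  · simp [elemSchur_zero]
  · intro i j hij
    have : (j : ℕ) < i := hij
    exact elemSchur_of_neg K (by omega)

/-- Summation along the diagonals of an upper triangular Toeplitz matrix. -/
theorem sum_sum_val_sub_val {A : Type*} [CommRing A] (n : ℕ) (f : ℤ → A) (hf : ∀ k < 0, f k = 0) :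
    ∑ a : Fin n, ∑ b : Fin n, f ((b : ℤ) - a) = ∑ d ∈ range n, ((n - d : ℕ) : A) * f d := by
  induction n with
  | zero => simp
  | succ n ih =>
    rw [Fin.sum_univ_castSucc]
    simp only [Fin.sum_univ_castSucc, Fin.val_castSucc, Fin.val_last]
    rw [sum_add_distrib, ih, sum_eq_zero (s := univ) (f := fun i : Fin n => f ((i : ℤ) - n)),
      sub_self, zero_add, sum_range_succ]
    · have h1 : ∑ a : Fin n, f ((n : ℤ) - a) + f 0 = ∑ d ∈ range (n + 1), f d := by
        rw [Fin.sum_univ_eq_sum_range (fun a : ℕ => f ((n : ℤ) - (a : ℤ))),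
          ← sum_range_reflect (fun d : ℕ => f (d : ℤ)), sum_range_succ]
        simp only [add_tsub_cancel_right, Nat.sub_self, Nat.cast_zero]
        congr 1
        refine sum_congr rfl fun a ha => ?_
        rw [Nat.cast_sub (mem_range.mp ha).le]
      rw [add_assoc, h1, sum_range_succ, ← add_assoc, ← sum_add_distrib]
      congr 1
      · refine sum_congr rfl fun d hd => ?_
        rw [Nat.succ_sub (mem_range.mp hd).le]
        push_cast
        ring
      · simp
    · intro i _
      exact hf _ (by omega)

/-- The sum is the trace of `U⁻¹ T` for the unitriangular matrix `U = (s_{b-a})` and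
`T = (s_{b-a+n})`, and the entries of `U⁻¹` are the coefficients of the inverse series. -/
theorem sum_jtDet_update_neg_val (n : ℕ) :
    ∑ b : Fin n, jtDet K (fun a : Fin n => -(a : ℤ))
      (Function.update (fun b : Fin n => (b : ℤ)) b ((b : ℤ) + n)) = powerSum K n := by
  set U : Matrix (Fin n) (Fin n) (TPoly K) :=
    Matrix.of fun a b => elemSchur K (-(a : ℤ) + (b : ℤ)) with hU
  set V : Matrix (Fin n) (Fin n) (TPoly K) :=
    Matrix.of fun a b => invSchur K ((b : ℤ) - (a : ℤ)) with hV
  have hdet : U.det = 1 := jtDet_neg_val n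
  have hUV : U * V = 1 := by
    ext1 a c
    rw [Matrix.mul_apply, Matrix.one_apply]
    simp only [hU, hV, Matrix.of_apply]
    rw [Fin.sum_univ_eq_sum_range
      (fun b : ℕ => elemSchur K (-(a : ℤ) + (b : ℤ)) * invSchur K ((c : ℤ) - (b : ℤ)))]
    rcases lt_or_ge c a with hca | hac
    · rw [if_neg hca.ne', sum_eq_zero]
      intro b _
      have : (c : ℕ) < a := hca
      rcases lt_or_ge b (a : ℕ) with hb | hb
      · rw [elemSchur_of_neg K (by omega), zero_mul]
      · rw [invSchur_of_neg K (by omega), mul_zero]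
    · obtain ⟨k, hk⟩ := Nat.exists_eq_add_of_le (show (a : ℕ) ≤ c from hac)
      have hcn := c.isLt
      have e : (if a = c then (1 : TPoly K) else 0) = if k = 0 then 1 else 0 := by
        simp only [Fin.ext_iff]
        congr 1
        simp only [eq_iff_iff]
        omega
      rw [e, ← sum_elemSchur_mul_invSchur]
      symm
      apply sum_of_injOn (fun p : ℕ × ℕ => (a : ℕ) + p.1)
      · intro p hp q hq hpq
        simp only [mem_coe, HasAntidiagonal.mem_antidiagonal] at hp hq hpq
        exact Prod.ext (by omega) (by omega)
      · intro p hp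
        simp only [mem_coe, HasAntidiagonal.mem_antidiagonal, mem_range] at hp ⊢
        omega
      · intro b _ hb
        rcases lt_or_ge b (a : ℕ) with hba | hba
        · rw [elemSchur_of_neg K (by omega), zero_mul]
        · rw [invSchur_of_neg K, mul_zero]
          by_contra hlt
          apply hb
          refine ⟨(b - a, c - b), ?_, ?_⟩
          · simp only [mem_coe, HasAntidiagonal.mem_antidiagonal]
            omega
          · simp only
            omega
      · intro p hp
        rw [HasAntidiagonal.mem_antidiagonal] at hp
        congr 2
        · push_cast
          ring
        · rw [hk]
          push_cast
          rw [← hp]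
          push_cast
          ring
  have hadj : U.adjugate = V := by
    calc U.adjugate = U.adjugate * (U * V) := by rw [hUV, mul_one]
      _ = V := by rw [← mul_assoc, Matrix.adjugate_mul, hdet, one_smul, one_mul]
  simp only [jtDet_update_right (fun a : Fin n => -(a : ℤ)) (fun b : Fin n => (b : ℤ))]
  simp only [← hU, ← Matrix.cramer_apply, Matrix.cramer_eq_adjugate_mulVec, hadj, Matrix.mulVec,
    dotProduct]
  have h := sum_sum_val_sub_val n (fun k : ℤ => invSchur K k * elemSchur K (n - k))
    (fun k hk => by rw [invSchur_of_neg K hk, zero_mul])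
  calc _ = ∑ a : Fin n, ∑ b : Fin n, (invSchur K ((b : ℤ) - a) *
          elemSchur K (n - ((b : ℤ) - a))) := by
        refine sum_congr rfl fun a _ => sum_congr rfl fun b _ => ?_
        rw [hV, Matrix.of_apply]
        congr 2
        ring
    _ = ∑ d ∈ range n, ((n - d : ℕ) : TPoly K) * (invSchur K d * elemSchur K (n - d)) := h
    _ = _ := by
        rw [← sum_invSchur_mul_natCast_mul_elemSchur, Nat.sum_antidiagonal_eq_sum_range_succ_mk,
          sum_range_succ]
        simp only [Nat.sub_self, Nat.cast_zero, zero_mul, mul_zero, add_zero]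
        refine sum_congr rfl fun d hd => ?_
        rw [Nat.cast_sub (mem_range.mp hd).le, Nat.cast_sub (mem_range.mp hd).le]
        ring

theorem rowLen_eq_zero {lam : YoungDiagram} {m : ℕ} (hm : lam.colLen 0 ≤ m) (i : ℕ) (hi : m ≤ i) :
    lam.rowLen i = 0 := by
  by_contra h
  have : (i, 0) ∈ lam := YoungDiagram.mem_iff_lt_rowLen.mpr (Nat.pos_of_ne_zero h)
  have := YoungDiagram.mem_iff_lt_colLen.mp this
  omega

/-- Rows beyond the last row of the partition do not change the Jacobi–Trudi determinant. -/
theorem jtDet_rowLen_add (lam : YoungDiagram) {m : ℕ} (hm : lam.colLen 0 ≤ m) (k : ℕ) :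
    jtDet K (fun i : Fin (m + k) => (lam.rowLen i : ℤ) - i) (fun j => (j : ℤ)) =
      jtDet K (fun i : Fin m => (lam.rowLen i : ℤ) - i) (fun j => (j : ℤ)) := by
  have h0 : ∀ i, m ≤ i → lam.rowLen i = 0 := rowLen_eq_zero hm
  rw [← jtDet_comp_equiv finSumFinEquiv]
  have hx : (fun i : Fin (m + k) => (lam.rowLen i : ℤ) - i) ∘ finSumFinEquiv =
      Sum.elim (fun i : Fin m => (lam.rowLen i : ℤ) - i) (fun a : Fin k => -(m : ℤ) - a) := by
    ext (i | a)
    · simp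
    · simp [h0]
      ring
  have hy : (fun j : Fin (m + k) => (j : ℤ)) ∘ finSumFinEquiv =
      Sum.elim (fun j : Fin m => (j : ℤ)) (fun b : Fin k => (m : ℤ) + b) := by
    ext (i | a) <;> simp
  rw [hx, hy, jtDet_sumElim _ _ _ _ (fun a i => by have := i.isLt; omega)]
  have h1 : jtDet K (fun a : Fin k => -(m : ℤ) - a) (fun b : Fin k => (m : ℤ) + b) = 1 := by
    rw [← jtDet_neg_val (K := K) k]
    exact jtDet_congr fun i j => by ring
  rw [h1, mul_one]

/-- Multiplication by a power sum raises the rows of the Jacobi–Trudi determinant one at a time.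
After passing to columns, only the last `n` of them contribute, and their contribution splits off
as a determinant that does not depend on the partition. -/
theorem sum_jtDet_rowLen_update (lam : YoungDiagram) {m : ℕ} (hm : lam.colLen 0 ≤ m) (n : ℕ+) :
    ∑ i, jtDet K (Function.update (fun i : Fin (m + n) => (lam.rowLen i : ℤ) - i) i
        ((lam.rowLen i : ℤ) - i + (n : ℕ))) (fun j => (j : ℤ)) =
      powerSum K n * jtDet K (fun i : Fin m => (lam.rowLen i : ℤ) - i) (fun j => (j : ℤ)) := by
  have h0 : ∀ i, m ≤ i → lam.rowLen i = 0 := rowLen_eq_zero hm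
  rw [sum_jtDet_update (fun i : Fin (m + n) => (lam.rowLen i : ℤ) - i) (fun j => (j : ℤ)),
    Fin.sum_univ_add, sum_eq_zero, zero_add, ← sum_jtDet_update_neg_val, sum_mul]
  · refine sum_congr rfl fun b _ => ?_
    rw [← jtDet_comp_equiv finSumFinEquiv]
    have hx : (fun i : Fin (m + n) => (lam.rowLen i : ℤ) - i) ∘ finSumFinEquiv =
        Sum.elim (fun i : Fin m => (lam.rowLen i : ℤ) - i) (fun a : Fin n => -(m : ℤ) - a) := by
      ext (i | a)
      · simp
      · simp [h0]
        ring
    have hy : Function.update (fun j : Fin (m + n) => (j : ℤ)) (Fin.natAdd m b)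
          (((Fin.natAdd m b : Fin (m + n)) : ℤ) + (n : ℕ)) ∘ finSumFinEquiv =
        Sum.elim (fun j : Fin m => (j : ℤ))
          (fun c => (m : ℤ) + Function.update (fun b : Fin n => (b : ℤ)) b ((b : ℤ) + (n : ℕ)) c) := by
      ext (j | c)
      · have : Fin.castAdd (n : ℕ) j ≠ Fin.natAdd m b := by
          intro h
          have := congrArg Fin.val h
          simp at this
          omega
        simp [this]
      · rcases eq_or_ne c b with rfl | hc
        · simp [add_assoc]
        · simp [hc]
    rw [hx, hy, jtDet_sumElim _ _ _ _ (fun a i => by have := i.isLt; omega), mul_comm]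
    congr 1
    exact jtDet_congr fun i j => by ring
  · -- a column among the first `m` becomes equal to the column `n` steps to its right
    intro a _
    have hn := n.pos
    have ha := a.isLt
    have hne : Fin.castAdd (n : ℕ) a ≠ (⟨a + n, by omega⟩ : Fin (m + n)) := by
      intro h
      have := congrArg Fin.val h
      simp at this
    refine jtDet_eq_zero_of_eq hne ?_
    rw [Function.update_self, Function.update_of_ne hne.symm]
    simp

end JacobiTrudi

/-! ### Beads -/

section Beads

variable {K : Type*} [Field K] [CharZero K]

/-- The positions of the `N` beads that encode a partition with at most `N` rows: the lengths of
its rows, made distinct by adding `N - 1, …, 1, 0`. -/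
def beads (N : ℕ) (lam : YoungDiagram) (i : Fin N) : ℕ := lam.rowLen i + (N - 1 - i)

variable (K) in
/-- The Jacobi–Trudi determinant of an arbitrary sequence of bead positions. The columns are
shifted so that the beads of a partition give its Schur polynomial, see `beadDet_beads`. -/
def beadDet (N : ℕ) (b : Fin N → ℕ) : TPoly K :=
  jtDet K (fun i => (b i : ℤ)) (fun j => (j : ℤ) + 1 - N)

theorem beadDet_comp_perm {N : ℕ} (b : Fin N → ℕ) (σ : Equiv.Perm (Fin N)) :
    beadDet K N (b ∘ σ) = ((Equiv.Perm.sign σ : ℤ) : TPoly K) * beadDet K N b :=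
  jtDet_comp_perm σ (fun i => (b i : ℤ)) _

theorem natCast_beads (N : ℕ) (lam : YoungDiagram) (i : Fin N) :
    (beads N lam i : ℤ) = lam.rowLen i + (N - 1 - i) := by
  have := i.isLt
  rw [beads]
  omega

theorem beadDet_beads {N : ℕ} {lam : YoungDiagram} (hN : lam.colLen 0 ≤ N) :
    beadDet K N (beads N lam) = schur K lam := by
  obtain ⟨k, rfl⟩ := Nat.exists_eq_add_of_le hN
  have h := jtDet_rowLen_add (K := K) lam le_rfl k
  rw [schur, ← jtDet, ← h, beadDet]
  refine jtDet_congr fun i j => ?_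
  rw [natCast_beads]
  ring

theorem powerSum_mul_schur {N : ℕ} {lam : YoungDiagram} (n : ℕ+) (hN : lam.colLen 0 + n ≤ N) :
    powerSum K n * schur K lam =
      ∑ i, beadDet K N (Function.update (beads N lam) i (beads N lam i + n)) := by
  obtain ⟨m, rfl⟩ : ∃ m, N = m + n := ⟨N - n, by omega⟩
  have hm : lam.colLen 0 ≤ m := by omega
  obtain ⟨k, rfl⟩ := Nat.exists_eq_add_of_le hm
  have h := jtDet_rowLen_add (K := K) lam le_rfl k
  rw [schur, ← jtDet, ← h, ← sum_jtDet_rowLen_update lam hm]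
  refine sum_congr rfl fun i _ => jtDet_congr fun a j => ?_
  rcases eq_or_ne a i with rfl | ha
  · simp only [Function.update_self]
    push_cast
    rw [natCast_beads]
    push_cast
    ring
  · simp only [Function.update_of_ne ha]
    rw [natCast_beads]
    push_cast
    ring

theorem pderiv_schur {N : ℕ} {lam : YoungDiagram} (n : ℕ+) (hN : lam.colLen 0 ≤ N) :
    MvPolynomial.pderiv n (schur K lam) =
      ∑ i with (n : ℕ) ≤ beads N lam i,
        beadDet K N (Function.update (beads N lam) i (beads N lam i - n)) := by
  rw [← beadDet_beads hN, beadDet, pderiv_jtDet, sum_filter]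
  refine sum_congr rfl fun i _ => ?_
  split_ifs with h
  · refine jtDet_congr fun a j => ?_
    rcases eq_or_ne a i with rfl | ha
    · simp only [Function.update_self]
      rw [Nat.cast_sub h]
      ring
    · simp only [Function.update_of_ne ha]
  · -- a row lowered below position `0` has only zero entries
    refine jtDet_eq_zero_of_neg i fun j => ?_
    have := j.isLt
    rw [Function.update_self]
    omega

end Beads

/-! ### Border strips in terms of row lengths -/

section Rows

theorem mem_skewCells {lam mu : YoungDiagram} {p : ℕ × ℕ} :
    p ∈ skewCells mu lam ↔ lam.rowLen p.1 ≤ p.2 ∧ p.2 < mu.rowLen p.1 := by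
  obtain ⟨i, c⟩ := p
  rw [skewCells, mem_sdiff, YoungDiagram.mem_cells, YoungDiagram.mem_cells,
    YoungDiagram.mem_iff_lt_rowLen, YoungDiagram.mem_iff_lt_rowLen, not_lt, and_comm]

theorem le_of_rowLen_le {lam mu : YoungDiagram} (h : ∀ i, lam.rowLen i ≤ mu.rowLen i) :
    lam ≤ mu := by
  rintro ⟨i, c⟩ hc
  rw [YoungDiagram.mem_iff_lt_rowLen] at hc ⊢
  exact hc.trans_le (h i)

theorem rowLen_le_of_le {lam mu : YoungDiagram} (h : lam ≤ mu) (i : ℕ) :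
    lam.rowLen i ≤ mu.rowLen i := by
  by_contra hlt
  have h1 : (i, mu.rowLen i) ∈ lam := YoungDiagram.mem_iff_lt_rowLen.mpr (not_le.mp hlt)
  have h2 := YoungDiagram.mem_iff_lt_rowLen.mp (h h1)
  exact lt_irrefl _ h2

theorem eq_of_rowLen_eq {lam mu : YoungDiagram} (h : ∀ i, lam.rowLen i = mu.rowLen i) :
    lam = mu :=
  le_antisymm (le_of_rowLen_le fun i => (h i).le) (le_of_rowLen_le fun i => (h i).ge)

theorem colLen_mono {lam mu : YoungDiagram} (h : lam ≤ mu) : lam.colLen 0 ≤ mu.colLen 0 := by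
  by_contra hlt
  have h1 : (mu.colLen 0, 0) ∈ lam := YoungDiagram.mem_iff_lt_colLen.mpr (not_le.mp hlt)
  have h2 := YoungDiagram.mem_iff_lt_colLen.mp (h h1)
  exact lt_irrefl _ h2

/-- The shape `mu \ lam` occupies the rows `r, …, s` and follows the rim of `lam` there: from one
row to the next, `mu` has exactly one box more than `lam` has in the row above. The last equation
says that there are `n` boxes. -/
structure IsRim (lam mu : YoungDiagram) (r s n : ℕ) : Prop where
  le : r ≤ s
  eq_of_lt : ∀ i < r, mu.rowLen i = lam.rowLen i
  eq_of_gt : ∀ i, s < i → mu.rowLen i = lam.rowLen i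
  succ : ∀ i, r ≤ i → i < s → mu.rowLen (i + 1) = lam.rowLen i + 1
  size : mu.rowLen r + s = lam.rowLen s + r + n
  pos : 0 < n

namespace IsRim

variable {lam mu : YoungDiagram} {r s n : ℕ}

theorem lt (h : IsRim lam mu r s n) {i : ℕ} (hr : r ≤ i) (hs : i ≤ s) :
    lam.rowLen i < mu.rowLen i := by
  rcases hr.eq_or_lt with rfl | hr
  · rcases hs.eq_or_lt with rfl | hs
    · have := h.size
      have := h.pos
      omega
    · have := h.succ r le_rfl hs
      have := mu.rowLen_anti r (r + 1) (Nat.le_succ r)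
      omega
  · obtain ⟨i, rfl⟩ : ∃ j, i = j + 1 := ⟨i - 1, by omega⟩
    have := h.succ i (by omega) (by omega)
    have := lam.rowLen_anti i (i + 1) (Nat.le_succ i)
    omega

theorem subset (h : IsRim lam mu r s n) : lam ≤ mu := by
  refine le_of_rowLen_le fun i => ?_
  rcases lt_or_ge i r with h1 | h1
  · exact (h.eq_of_lt i h1).ge
  · rcases lt_or_ge s i with h2 | h2
    · exact (h.eq_of_gt i h2).ge
    · exact (h.lt h1 h2).le

theorem row_mem (h : IsRim lam mu r s n) {p : ℕ × ℕ} (hp : p ∈ skewCells mu lam) :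
    r ≤ p.1 ∧ p.1 ≤ s := by
  rw [mem_skewCells] at hp
  constructor
  · by_contra hlt
    have := h.eq_of_lt p.1 (by omega)
    omega
  · by_contra hlt
    have := h.eq_of_gt p.1 (by omega)
    omega

theorem image_fst (h : IsRim lam mu r s n) : (skewCells mu lam).image Prod.fst = Icc r s := by
  ext i
  rw [mem_image, mem_Icc]
  constructor
  · rintro ⟨p, hp, rfl⟩
    exact h.row_mem hp
  · rintro ⟨h1, h2⟩
    exact ⟨(i, lam.rowLen i), mem_skewCells.mpr ⟨le_rfl, h.lt h1 h2⟩, rfl⟩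

theorem ht_eq (h : IsRim lam mu r s n) : ht mu lam = s - r := by
  have := h.le
  rw [ht, h.image_fst, Nat.card_Icc]
  omega

theorem card_eq (h : IsRim lam mu r s n) : (skewCells mu lam).card = n := by
  have h1 : (skewCells mu lam).card = ∑ i ∈ Icc r s, (mu.rowLen i - lam.rowLen i) := by
    rw [card_eq_sum_card_image Prod.fst, h.image_fst]
    refine sum_congr rfl fun i _ => ?_
    rw [← Nat.card_Ico, ← card_map (Function.Embedding.sectR i ℕ)]
    congr 1
    ext ⟨a, c⟩
    simp only [mem_filter, mem_skewCells, mem_map, mem_Ico, Function.Embedding.sectR_apply,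
      Prod.mk.injEq]
    constructor
    · rintro ⟨hc, rfl⟩
      exact ⟨c, hc, rfl, rfl⟩
    · rintro ⟨c', hc, rfl, rfl⟩
      exact ⟨hc, rfl⟩
  have h2 : ∀ t, r ≤ t → t ≤ s →
      ∑ i ∈ Icc r t, (mu.rowLen i - lam.rowLen i) + lam.rowLen t + r = mu.rowLen r + t := by
    intro t ht
    induction t, ht using Nat.le_induction with
    | base =>
      intro hs
      have := h.lt le_rfl hs
      simp
      omega
    | succ t ht ih =>
      intro hs
      have h3 := ih (by omega)
      have h4 := h.lt (by omega : r ≤ t + 1) hs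
      have h5 := h.succ t ht (by omega)
      rw [sum_Icc_succ_top (by omega)]
      omega
  have h3 := h2 s h.le le_rfl
  have h4 := h.size
  omega

theorem reachable_row {i a : ℕ} (ha : lam.rowLen i ≤ a) {c : ℕ} (hac : a ≤ c)
    (hp : (i, c) ∈ (skewCells mu lam : Set (ℕ × ℕ)))
    (hq : (i, a) ∈ (skewCells mu lam : Set (ℕ × ℕ))) :
    ((SimpleGraph.hasse (ℕ × ℕ)).induce (skewCells mu lam : Set (ℕ × ℕ))).Reachable
      ⟨(i, c), hp⟩ ⟨(i, a), hq⟩ := by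
  induction c, hac using Nat.le_induction with
  | base => exact SimpleGraph.Reachable.refl _
  | succ c hac ih =>
    have h1 := mem_skewCells.mp (mem_coe.mp hp)
    have h3 : (i, c) ∈ (skewCells mu lam : Set (ℕ × ℕ)) :=
      mem_coe.mpr (mem_skewCells.mpr ⟨ha.trans hac, (Nat.lt_succ_self c).trans h1.2⟩)
    refine SimpleGraph.Reachable.trans (SimpleGraph.Adj.reachable ?_) (ih h3)
    rw [SimpleGraph.induce_adj, hasse_adj_iff]
    simp

theorem reachable (h : IsRim lam mu r s n)
    (hq : (r, lam.rowLen r) ∈ (skewCells mu lam : Set (ℕ × ℕ))) {i : ℕ} (hi : r ≤ i) :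
    ∀ c, ∀ hp : (i, c) ∈ (skewCells mu lam : Set (ℕ × ℕ)),
      ((SimpleGraph.hasse (ℕ × ℕ)).induce (skewCells mu lam : Set (ℕ × ℕ))).Reachable
        ⟨(i, c), hp⟩ ⟨(r, lam.rowLen r), hq⟩ := by
  induction i, hi using Nat.le_induction with
  | base =>
    intro c hp
    exact reachable_row le_rfl (mem_skewCells.mp (mem_coe.mp hp)).1 _ _
  | succ i hi ih =>
    intro c hp
    have h0 := h.row_mem (mem_coe.mp hp)
    have h1 := mem_skewCells.mp (mem_coe.mp hp)
    simp only at h0 h1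
    have h2 := h.succ i hi (by omega)
    have h3 := lam.rowLen_anti i (i + 1) (Nat.le_succ i)
    have h4 := h.lt hi (by omega)
    -- the last box of the row `i + 1` lies below the first box of the row `i`
    have m1 : (i + 1, lam.rowLen i) ∈ (skewCells mu lam : Set (ℕ × ℕ)) :=
      mem_coe.mpr (mem_skewCells.mpr ⟨h3, by simp only; omega⟩)
    have m2 : (i, lam.rowLen i) ∈ (skewCells mu lam : Set (ℕ × ℕ)) :=
      mem_coe.mpr (mem_skewCells.mpr ⟨le_rfl, h4⟩)
    refine (reachable_row h1.1 (by omega) m1 hp).symm.trans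
      (SimpleGraph.Reachable.trans (SimpleGraph.Adj.reachable ?_) (ih _ m2))
    rw [SimpleGraph.induce_adj, hasse_adj_iff]
    simp

theorem isBorderStrip (h : IsRim lam mu r s n) : IsBorderStrip mu lam n := by
  have hq : (r, lam.rowLen r) ∈ (skewCells mu lam : Set (ℕ × ℕ)) :=
    mem_coe.mpr (mem_skewCells.mpr ⟨le_rfl, h.lt le_rfl h.le⟩)
  refine ⟨h.subset, h.card_eq, ?_, ?_⟩
  · rw [SimpleGraph.connected_iff_exists_forall_reachable]
    exact ⟨⟨_, hq⟩, fun p => (h.reachable hq (h.row_mem p.2).1 p.1.2 p.2).symm⟩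
  · rintro i c ⟨h1, -, -, h4⟩
    have h5 := h.row_mem h1
    have h6 := h.row_mem h4
    rw [mem_skewCells] at h1 h4
    simp only at h1 h4 h5 h6
    have := h.succ i h5.1 (by omega)
    omega

end IsRim

theorem exists_col_of_connected {lam mu : YoungDiagram}
    (hc : ((SimpleGraph.hasse (ℕ × ℕ)).induce (skewCells mu lam : Set (ℕ × ℕ))).Connected)
    {i : ℕ} {p q : ℕ × ℕ} (hp : p ∈ skewCells mu lam) (hq : q ∈ skewCells mu lam)
    (hpi : p.1 ≤ i) (hqi : i < q.1) :
    ∃ c, (i, c) ∈ skewCells mu lam ∧ (i + 1, c) ∈ skewCells mu lam := by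
  obtain ⟨w⟩ := hc.preconnected ⟨p, mem_coe.mpr hp⟩ ⟨q, mem_coe.mpr hq⟩
  obtain ⟨⟨⟨⟨⟨a1, a2⟩, ha⟩, ⟨⟨b1, b2⟩, hb⟩⟩, hadj⟩, -, h1, h2⟩ :=
    w.exists_boundary_dart {x | x.1.1 ≤ i} hpi (by simpa using hqi)
  rw [SimpleGraph.induce_adj, hasse_adj_iff] at hadj
  simp only [Set.mem_ofPred_eq, not_le] at h1 h2
  simp only at hadj
  obtain ⟨rfl, rfl, rfl⟩ : a2 = b2 ∧ a1 = i ∧ b1 = i + 1 := by omega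
  exact ⟨a2, ha, hb⟩

/-- A border strip follows the rim: consecutive rows overlap by connectedness, and they overlap in
only one column as there is no `2 × 2` square. -/
theorem exists_isRim {lam mu : YoungDiagram} {n : ℕ} (h : IsBorderStrip mu lam n) :
    ∃ r s, IsRim lam mu r s n := by
  obtain ⟨hle, hcard, hconn, hsq⟩ := h
  obtain ⟨⟨p, hp⟩⟩ := hconn.nonempty
  have hne : ((skewCells mu lam).image Prod.fst).Nonempty := ⟨p.1, mem_image_of_mem _ hp⟩
  obtain ⟨pr, hpr, hr⟩ := mem_image.mp (min'_mem _ hne)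
  obtain ⟨ps, hps, hs⟩ := mem_image.mp (max'_mem _ hne)
  set r := ((skewCells mu lam).image Prod.fst).min' hne
  set s := ((skewCells mu lam).image Prod.fst).max' hne
  have hrs : r ≤ s := min'_le_max' _ hne
  have hrow : ∀ q ∈ skewCells mu lam, r ≤ q.1 ∧ q.1 ≤ s := fun q hq =>
    ⟨min'_le _ _ (mem_image_of_mem _ hq), le_max' _ _ (mem_image_of_mem _ hq)⟩
  have heq : ∀ i, ¬ (r ≤ i ∧ i ≤ s) → mu.rowLen i = lam.rowLen i := by
    intro i hi
    by_contra hne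
    refine hi (hrow (i, lam.rowLen i) (mem_skewCells.mpr ⟨le_rfl, ?_⟩))
    exact lt_of_le_of_ne (rowLen_le_of_le hle i) (Ne.symm hne)
  have hsucc : ∀ i, r ≤ i → i < s → mu.rowLen (i + 1) = lam.rowLen i + 1 := by
    intro i h1 h2
    obtain ⟨c, hc1, hc2⟩ := exists_col_of_connected hconn hpr hps (hr.trans_le h1) (hs ▸ h2)
    rw [mem_skewCells] at hc1 hc2
    simp only at hc1 hc2
    have h3 := mu.rowLen_anti i (i + 1) (Nat.le_succ i)
    have h4 := lam.rowLen_anti i (i + 1) (Nat.le_succ i)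
    by_contra hne
    apply hsq i (lam.rowLen i)
    simp only [mem_skewCells]
    omega
  have hpos : 0 < n := hcard ▸ card_pos.mpr ⟨p, hp⟩
  -- the shape has the rows of a rim of some size, which then is the number of its boxes
  have hsize : lam.rowLen s + r < mu.rowLen r + s := by
    have h1 := (mem_skewCells.mp hps)
    rw [hs] at h1
    have h2 : mu.rowLen s ≤ mu.rowLen r := mu.rowLen_anti r s hrs
    omega
  have hrim : IsRim lam mu r s (mu.rowLen r + s - (lam.rowLen s + r)) :=
    ⟨hrs, fun i hi => heq i (by omega), fun i hi => heq i (by omega), hsucc, by omega, by omega⟩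
  refine ⟨r, s, ?_⟩
  rw [← hcard, hrim.card_eq]
  exact hrim

theorem IsBorderStrip.pos {lam mu : YoungDiagram} {n : ℕ} (h : IsBorderStrip mu lam n) : 0 < n := by
  obtain ⟨r, s, h⟩ := exists_isRim h
  exact h.pos

end Rows

/-! ### Border strips as moves of a bead -/

section BeadMoves

variable {N : ℕ}

theorem strictAnti_beads {lam : YoungDiagram} : StrictAnti (beads N lam) := by
  intro i j hij
  have h1 := lam.rowLen_anti i j hij.le
  have h2 : (i : ℕ) < j := hij
  have := j.isLt
  simp only [beads]
  omega

theorem beads_injective {lam mu : YoungDiagram} (hl : lam.colLen 0 ≤ N) (hm : mu.colLen 0 ≤ N)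
    (h : beads N lam = beads N mu) : lam = mu := by
  refine eq_of_rowLen_eq fun i => ?_
  rcases lt_or_ge i N with hi | hi
  · have := congrFun h ⟨i, hi⟩
    simpa [beads] using this
  · rw [rowLen_eq_zero hl i hi, rowLen_eq_zero hm i hi]

theorem strictAnti_add_sub_le {g : Fin N → ℕ} (hg : StrictAnti g) {i j : Fin N} (hij : i ≤ j) :
    g j + (j - i) ≤ g i := by
  obtain ⟨j, hj⟩ := j
  obtain ⟨i, hi⟩ := i
  replace hij : i ≤ j := hij
  induction j, hij using Nat.le_induction with
  | base => simp
  | succ j hij ih =>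
    have h1 := ih (by omega)
    have h2 : g ⟨j + 1, hj⟩ < g ⟨j, by omega⟩ := hg (Nat.lt_succ_self j)
    simp only at h1 ⊢
    omega

/-- The Young diagram whose row lengths are a given antitone sequence that is eventually zero. -/
def ofAntitone (f : ℕ → ℕ) (hf : Antitone f) (N : ℕ) : YoungDiagram where
  cells := {p ∈ range N ×ˢ range (f 0) | p.2 < f p.1}
  isLowerSet := by
    rintro ⟨i, c⟩ ⟨i', c'⟩ ⟨h1, h2⟩ h
    simp only [coe_filter, mem_product, mem_range, Set.mem_ofPred_eq] at h h1 h2 ⊢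
    have := hf h1
    omega

theorem rowLen_ofAntitone {f : ℕ → ℕ} (hf : Antitone f) {N : ℕ} (hN : ∀ i, N ≤ i → f i = 0)
    (i : ℕ) : (ofAntitone f hf N).rowLen i = f i := by
  have h : ∀ c, c < (ofAntitone f hf N).rowLen i ↔ c < f i := by
    intro c
    rw [← YoungDiagram.mem_iff_lt_rowLen, ← YoungDiagram.mem_cells, ofAntitone]
    simp only [mem_filter, mem_product, mem_range, and_iff_right_iff_imp]
    intro hc
    refine ⟨?_, hc.trans_le (hf (Nat.zero_le i))⟩
    by_contra hi
    have := hN i (not_lt.mp hi)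
    omega
  exact le_antisymm (not_lt.mp fun hlt => lt_irrefl _ ((h _).mp hlt))
    (not_lt.mp fun hlt => lt_irrefl _ ((h _).mpr hlt))

theorem exists_beads_eq {g : Fin N → ℕ} (hg : StrictAnti g) :
    ∃ mu : YoungDiagram, mu.colLen 0 ≤ N ∧ beads N mu = g := by
  set f : ℕ → ℕ := fun i => if h : i < N then g ⟨i, h⟩ - (N - 1 - i) else 0 with hf
  have hN : ∀ i, N ≤ i → f i = 0 := fun i hi => by simp [hf, not_lt.mpr hi]
  have hanti : Antitone f := by
    intro i j hij
    rcases lt_or_ge j N with hj | hj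
    · have h1 := strictAnti_add_sub_le hg (show (⟨i, by omega⟩ : Fin N) ≤ ⟨j, hj⟩ from hij)
      simp only at h1
      simp only [hf, hj, show i < N by omega, dif_pos]
      omega
    · rw [hN j hj]
      exact Nat.zero_le _
  have hrow := rowLen_ofAntitone hanti hN
  refine ⟨ofAntitone f hanti N, ?_, ?_⟩
  · by_contra hlt
    have h1 := YoungDiagram.mem_iff_lt_colLen.mpr (not_le.mp hlt)
    rw [YoungDiagram.mem_iff_lt_rowLen, hrow, hN N le_rfl] at h1
    exact Nat.not_lt_zero _ h1
  · funext i
    have hi := i.isLt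
    have h1 := strictAnti_add_sub_le hg
      (show i ≤ (⟨N - 1, by omega⟩ : Fin N) from by rw [Fin.le_def]; simp only; omega)
    simp only at h1
    rw [beads, hrow]
    simp only [hf, hi, dif_pos, Fin.eta]
    omega

theorem exists_perm_strictAnti {f : Fin N → ℕ} (hf : Function.Injective f) :
    ∃ σ : Equiv.Perm (Fin N), StrictAnti (f ∘ σ) := by
  refine ⟨Fin.revPerm.trans (Tuple.sort f), ?_⟩
  have h := (Tuple.monotone_sort f).strictMono_of_injective
    (hf.comp (Tuple.sort f).injective)
  intro i j hij
  exact h (Fin.rev_lt_rev.mpr hij)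

theorem strictAnti_eq_of_comp_perm_eq {f g : Fin N → ℕ} (hf : StrictAnti f) (hg : StrictAnti g)
    {σ τ : Equiv.Perm (Fin N)} (h : f ∘ σ = g ∘ τ) : f = g ∧ σ = τ := by
  have hfg : f = g := by
    rw [← hf.range_inj hg, ← σ.surjective.range_comp f, h, τ.surjective.range_comp]
  subst hfg
  exact ⟨rfl, Equiv.ext fun i => hf.injective (congrFun h i)⟩

/-- Adding a rim to a partition moves one bead: the bead `s` jumps over the beads `r, …, s - 1`. -/
theorem isRim_iff_beads {lam mu : YoungDiagram} (hl : lam.colLen 0 ≤ N) (hm : mu.colLen 0 ≤ N)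
    {r s : Fin N} (hrs : r ≤ s) {n : ℕ} (hn : 0 < n) :
    IsRim lam mu r s n ↔ beads N mu ∘ Fin.cycleIcc r s =
      Function.update (beads N lam) s (beads N lam s + n) := by
  have : NeZero N := ⟨by have := r.isLt; omega⟩
  have hval : ∀ k : Fin N, k < s → ((k + 1 : Fin N) : ℕ) = k + 1 := fun k hk =>
    Fin.val_add_one_of_lt' (by have h1 := s.isLt; have h2 : (k : ℕ) < s := hk; omega)
  have hrN := r.isLt
  have hsN := s.isLt
  have hrs' : (r : ℕ) ≤ s := hrs
  constructor
  · intro h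
    funext k
    have hkN := k.isLt
    rw [Function.comp_apply]
    rcases lt_or_ge k r with h1 | h1
    · rw [Fin.cycleIcc_of_lt h1, Function.update_of_ne (h1.trans_le hrs).ne, beads, beads,
        h.eq_of_lt k h1]
    · rcases lt_trichotomy k s with h2 | rfl | h2
      · have h2' : (k : ℕ) < s := h2
        rw [Fin.cycleIcc_of_ge_of_lt h1 h2, Function.update_of_ne h2.ne, beads, beads, hval k h2,
          h.succ k h1 h2]
        omega
      · have := h.size
        rw [Fin.cycleIcc_of_last h1, Function.update_self, beads, beads]
        omega
      · rw [Fin.cycleIcc_of_gt h2, Function.update_of_ne h2.ne', beads, beads, h.eq_of_gt k h2]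
  · intro h
    have h' : ∀ k, beads N mu (Fin.cycleIcc r s k) =
      Function.update (beads N lam) s (beads N lam s + n) k := fun k => congrFun h k
    refine ⟨hrs, fun i hi => ?_, fun i hi => ?_, fun i h1 h2 => ?_, ?_, hn⟩
    · have hi' : (⟨i, by omega⟩ : Fin N) < r := hi
      have h1 := h' ⟨i, by omega⟩
      rw [Fin.cycleIcc_of_lt hi', Function.update_of_ne (hi'.trans_le hrs).ne, beads, beads] at h1
      simpa using h1
    · rcases lt_or_ge i N with hN | hN
      · have hi' : s < (⟨i, hN⟩ : Fin N) := hi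
        have h1 := h' ⟨i, hN⟩
        rw [Fin.cycleIcc_of_gt hi', Function.update_of_ne hi'.ne', beads, beads] at h1
        simpa using h1
      · rw [rowLen_eq_zero hl i hN, rowLen_eq_zero hm i hN]
    · have h2' : (⟨i, by omega⟩ : Fin N) < s := h2
      have h3 := h' ⟨i, by omega⟩
      rw [Fin.cycleIcc_of_ge_of_lt h1 h2', Function.update_of_ne h2'.ne, beads, beads,
        hval _ h2'] at h3
      simp only at h3
      omega
    · have h1 := h' s
      rw [Fin.cycleIcc_of_last hrs, Function.update_self, beads, beads] at h1
      omega

/-- Raising a bead of `lam` by `n` gives the beads of `mu`, up to the permutation `σ` of the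
beads. -/
def IsMove (lam mu : YoungDiagram) (n : ℕ) (s : Fin N) (σ : Equiv.Perm (Fin N)) : Prop :=
  beads N mu ∘ σ = Function.update (beads N lam) s (beads N lam s + n)

/-- Adding a border strip moves one bead, and its sign is that of the permutation of the beads. -/
theorem exists_isMove {lam mu : YoungDiagram} {n : ℕ} (h : IsBorderStrip mu lam n)
    (hm : mu.colLen 0 ≤ N) : ∃ (s : Fin N) (σ : Equiv.Perm (Fin N)),
      IsMove lam mu n s σ ∧ Equiv.Perm.sign σ = (-1) ^ ht mu lam := by
  obtain ⟨r, s, h⟩ := exists_isRim h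
  have hs : s < N := by
    refine lt_of_lt_of_le ?_ hm
    rw [← YoungDiagram.mem_iff_lt_colLen, YoungDiagram.mem_iff_lt_rowLen]
    exact (Nat.zero_le _).trans_lt (h.lt h.le le_rfl)
  have hrs : (⟨r, h.le.trans_lt hs⟩ : Fin N) ≤ ⟨s, hs⟩ := h.le
  refine ⟨⟨s, hs⟩, Fin.cycleIcc ⟨r, h.le.trans_lt hs⟩ ⟨s, hs⟩, ?_, ?_⟩
  · exact (isRim_iff_beads ((colLen_mono h.subset).trans hm) hm hrs h.pos).mp h
  · rw [Fin.sign_cycleIcc_of_le hrs, h.ht_eq]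

/-- A bead that can be raised by `n` without meeting another bead gives rise to a border strip.
The raised bead has to jump over the beads from the first one that is below its new position. -/
theorem exists_isBorderStrip {lam : YoungDiagram} (hl : lam.colLen 0 ≤ N) {n : ℕ} (hn : 0 < n)
    {s : Fin N} (hs : ∀ i, beads N lam i ≠ beads N lam s + n) :
    ∃ (mu : YoungDiagram) (σ : Equiv.Perm (Fin N)), mu.colLen 0 ≤ N ∧ IsBorderStrip mu lam n ∧
      IsMove lam mu n s σ ∧ Equiv.Perm.sign σ = (-1) ^ ht mu lam := by
  classical
  have : NeZero N := ⟨by have := s.isLt; omega⟩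
  obtain ⟨r, hr, hrmin⟩ : ∃ r, beads N lam r < beads N lam s + n ∧
      ∀ i < r, beads N lam s + n < beads N lam i := by
    have hne : ({i | beads N lam i < beads N lam s + n} : Finset (Fin N)).Nonempty :=
      ⟨s, by simp [hn]⟩
    refine ⟨_, (mem_filter.mp (min'_mem _ hne)).2, fun i hi => ?_⟩
    refine lt_of_le_of_ne (not_lt.mp fun hlt => ?_) (hs i).symm
    exact absurd (min'_le _ i (by simpa using hlt)) (not_le.mpr hi)
  have hrs : r ≤ s := by
    by_contra hlt
    have := hrmin s (not_le.mp hlt)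
    omega
  set b := beads N lam with hb
  have hanti : StrictAnti b := strictAnti_beads
  have hrs' : (r : ℕ) ≤ s := hrs
  have hbn : ∀ {i j : ℕ} (hi : i < N) (hj : j < N), i < j → b ⟨j, hj⟩ < b ⟨i, hi⟩ :=
    fun hi hj hij => hanti hij
  set g : Fin N → ℕ := fun k => if k < r then b k else if k = r then b s + n else
    if k ≤ s then b ⟨k - 1, by omega⟩ else b k with hg
  have hgc : g ∘ Fin.cycleIcc r s = Function.update b s (b s + n) := by
    funext k
    rw [Function.comp_apply]
    rcases lt_or_ge k r with h1 | h1
    · rw [Fin.cycleIcc_of_lt h1, Function.update_of_ne (h1.trans_le hrs).ne]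
      simp [hg, h1]
    · rcases lt_trichotomy k s with h2 | rfl | h2
      · have h2' : (k : ℕ) < s := h2
        have hval : ((k + 1 : Fin N) : ℕ) = k + 1 :=
          Fin.val_add_one_of_lt' (by have := s.isLt; omega)
        have h1' : (r : ℕ) ≤ k := h1
        rw [Fin.cycleIcc_of_ge_of_lt h1 h2, Function.update_of_ne h2.ne]
        simp only [hg]
        rw [if_neg (by rw [Fin.lt_def, hval]; omega), if_neg (by rw [Fin.ext_iff, hval]; omega),
          if_pos (by rw [Fin.le_def, hval]; omega)]
        congr 1
        ext
        simp [hval]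
      · rw [Fin.cycleIcc_of_last h1, Function.update_self]
        simp [hg]
      · rw [Fin.cycleIcc_of_gt h2, Function.update_of_ne h2.ne']
        simp only [hg]
        rw [if_neg (not_lt.mpr h1), if_neg (hrs.trans_lt h2).ne', if_neg (not_le.mpr h2)]
  have hg' : StrictAnti g := by
    intro i j hij
    obtain ⟨i, hi⟩ := i
    obtain ⟨j, hj⟩ := j
    replace hij : i < j := hij
    have hrmin' : i < r → b s + n < b ⟨i, hi⟩ := fun h => hrmin ⟨i, hi⟩ h
    have hr' : (r : ℕ) < j → b ⟨j - 1, by omega⟩ < b s + n := fun h =>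
      (hanti.antitone (show r ≤ ⟨j - 1, by omega⟩ from Nat.le_sub_one_of_lt h)).trans_lt hr
    have hs' : (s : ℕ) < j → b ⟨j, hj⟩ < b s := fun h => hanti (show s < ⟨j, hj⟩ from h)
    have h1 := hbn hi hj hij
    have h2 : 0 < i → b ⟨j - 1, by omega⟩ < b ⟨i - 1, by omega⟩ := fun h =>
      hbn (by omega) (by omega) (by omega)
    have h3 : b ⟨j, hj⟩ < b ⟨i - 1, by omega⟩ := hbn (by omega) hj (by omega)
    have h4 : i < j - 1 → b ⟨j - 1, by omega⟩ < b ⟨i, hi⟩ := fun h => hbn hi (by omega) h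
    simp only [hg, Fin.lt_def, Fin.le_def, Fin.ext_iff]
    split_ifs <;> omega
  obtain ⟨mu, hm, hmu⟩ := exists_beads_eq hg'
  have hrim : IsRim lam mu r s n := by
    rw [isRim_iff_beads hl hm hrs hn, hmu, hgc]
  refine ⟨mu, Fin.cycleIcc r s, hm, hrim.isBorderStrip, ?_, ?_⟩
  · rw [IsMove, hmu, hgc]
  · rw [Fin.sign_cycleIcc_of_le hrs, hrim.ht_eq]

namespace IsMove

variable {lam mu mu' : YoungDiagram} {n : ℕ} {s t : Fin N} {σ τ : Equiv.Perm (Fin N)}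

theorem apply_self (h : IsMove lam mu n s σ) : beads N mu (σ s) = beads N lam s + n := by
  have := congrFun h s
  simpa using this

theorem apply_of_ne (h : IsMove lam mu n s σ) {k : Fin N} (hk : k ≠ s) :
    beads N mu (σ k) = beads N lam k := by
  have := congrFun h k
  simpa [hk] using this

theorem right_unique (h : IsMove lam mu n s σ) (h' : IsMove lam mu' n s τ)
    (hm : mu.colLen 0 ≤ N) (hm' : mu'.colLen 0 ≤ N) : mu = mu' :=
  beads_injective hm hm' (strictAnti_eq_of_comp_perm_eq strictAnti_beads strictAnti_beads (h.trans h'.symm)).1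

theorem ne_add (h : IsMove lam mu n s σ) (hn : 0 < n) (k : Fin N) :
    beads N lam k ≠ beads N lam s + n := by
  rcases eq_or_ne k s with rfl | hk
  · omega
  · rw [← h.apply_self, ← h.apply_of_ne hk]
    exact fun e => hk (σ.injective (strictAnti_beads.injective e))

theorem bead_unique (h : IsMove lam mu n s σ) (h' : IsMove lam mu n t τ) (hn : 0 < n) : s = t := by
  by_contra hne
  -- the old position of the bead `s` is occupied after the move of `t`, but not after that of `s`
  have h1 := h'.apply_of_ne hne
  obtain ⟨k, hk⟩ := σ.surjective (τ s)
  rw [← hk] at h1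
  rcases eq_or_ne k s with rfl | hks
  · rw [h.apply_self] at h1
    omega
  · rw [h.apply_of_ne hks] at h1
    exact hks (strictAnti_beads.injective h1)

/-- The reversed move lowers a bead of the larger partition. -/
theorem update_sub (h : IsMove lam mu n s σ) :
    Function.update (beads N mu) (σ s) (beads N mu (σ s) - n) ∘ σ = beads N lam := by
  funext k
  rcases eq_or_ne k s with rfl | hk
  · simp [h.apply_self]
  · simp [hk, h.apply_of_ne hk]

end IsMove

/-- A bead that can be lowered by `n` without meeting another bead gives rise to a border strip. -/
theorem exists_isBorderStrip_sub {lam : YoungDiagram} (hl : lam.colLen 0 ≤ N) {n : ℕ} (hn : 0 < n)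
    {t : Fin N} (hnt : n ≤ beads N lam t) (ht' : ∀ i, beads N lam i ≠ beads N lam t - n) :
    ∃ (nu : YoungDiagram) (s : Fin N) (σ : Equiv.Perm (Fin N)), IsBorderStrip lam nu n ∧
      IsMove nu lam n s σ ∧ σ s = t ∧ Equiv.Perm.sign σ = (-1) ^ ht lam nu := by
  set f := Function.update (beads N lam) t (beads N lam t - n) with hf
  have hinj : Function.Injective f := by
    intro i j hij
    rcases eq_or_ne i t with rfl | hi <;> rcases eq_or_ne j i with rfl | hj
    · rfl
    · exact absurd (by simpa [hf, hj] using hij.symm) (ht' j)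
    · rfl
    · rcases eq_or_ne j t with rfl | hjt
      · exact absurd (by simpa [hf, hi] using hij) (ht' i)
      · exact strictAnti_beads.injective (by simpa [hf, hi, hjt] using hij)
  obtain ⟨τ, hτ⟩ := exists_perm_strictAnti hinj
  obtain ⟨nu, hnuN, hnu⟩ := exists_beads_eq hτ
  have hself : beads N nu (τ.symm t) = beads N lam t - n := by simp [hnu, hf]
  have hmove : IsMove nu lam n (τ.symm t) τ := by
    funext k
    rcases eq_or_ne k (τ.symm t) with rfl | hk
    · simp [hself, hnt]
    · have : τ k ≠ t := fun e => hk (by simp [← e])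
      simp [hk, hnu, hf, this]
  obtain ⟨mu, σ, hm, hstrip, hσ, hsign⟩ := exists_isBorderStrip hnuN hn (hmove.ne_add hn)
  obtain rfl := hmove.right_unique hσ hl hm
  obtain rfl := (strictAnti_eq_of_comp_perm_eq strictAnti_beads strictAnti_beads (hmove.trans hσ.symm)).2
  exact ⟨nu, _, τ, hstrip, hσ, by simp, hsign⟩

end BeadMoves

/-! ### Sums over the moves of one bead -/

section BeadSums

theorem finite_card_le (M : ℕ) : {mu : YoungDiagram | mu.cells.card ≤ M}.Finite := by
  refine Set.Finite.of_finite_image (f := YoungDiagram.cells) ?_ ?_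
  · refine (range M ×ˢ range M).powerset.finite_toSet.subset ?_
    rintro _ ⟨mu, h, rfl⟩
    rw [Set.mem_ofPred_eq] at h
    rw [mem_coe, mem_powerset]
    rintro ⟨i, c⟩ hc
    have h1 := YoungDiagram.mem_iff_lt_rowLen.mp (YoungDiagram.mem_cells _ |>.mp hc)
    have h2 := YoungDiagram.mem_iff_lt_colLen.mp (YoungDiagram.mem_cells _ |>.mp hc)
    rw [YoungDiagram.rowLen_eq_card] at h1
    rw [YoungDiagram.colLen_eq_card] at h2
    have h3 : (mu.row i).card ≤ mu.cells.card := card_le_card (filter_subset _ _)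
    have h4 : (mu.col c).card ≤ mu.cells.card := card_le_card (filter_subset _ _)
    rw [mem_product, mem_range, mem_range]
    simp only
    omega
  · intro a _ b _ h
    exact YoungDiagram.ext h

/-- The finite set of all partitions with at most `M` boxes. -/
def diagrams (M : ℕ) : Finset YoungDiagram := (finite_card_le M).toFinset

theorem mem_diagrams {M : ℕ} {mu : YoungDiagram} : mu ∈ diagrams M ↔ mu.cells.card ≤ M := by
  simp [diagrams]

theorem IsBorderStrip.card_eq {lam mu : YoungDiagram} {n : ℕ} (h : IsBorderStrip mu lam n) :
    mu.cells.card = lam.cells.card + n := by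
  have h1 := h.2.1
  have h2 : lam.cells ⊆ mu.cells := YoungDiagram.cells_subset_iff.mpr h.1
  have h3 := card_le_card h2
  rw [skewCells, card_sdiff_of_subset h2] at h1
  omega

open Classical in
/-- The sign `(-1) ^ ht` of a border strip, extended by zero to the shapes that are not border
strips of size `n`. -/
def stripSign (mu lam : YoungDiagram) (n : ℕ) : ℤ :=
  if IsBorderStrip mu lam n then (-1) ^ ht mu lam else 0

theorem stripSign_of_pos {mu lam : YoungDiagram} {n : ℕ} (h : IsBorderStrip mu lam n) :
    stripSign mu lam n = (-1) ^ ht mu lam := if_pos h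

theorem stripSign_of_neg {mu lam : YoungDiagram} {n : ℕ} (h : ¬ IsBorderStrip mu lam n) :
    stripSign mu lam n = 0 := if_neg h

variable {N : ℕ} {A : Type*} [CommRing A]

/-- Functions of bead positions that change by the sign when the beads are permuted. -/
def IsSkew (E : (Fin N → ℕ) → A) : Prop :=
  ∀ (b : Fin N → ℕ) (σ : Equiv.Perm (Fin N)), E (b ∘ σ) = ((Equiv.Perm.sign σ : ℤ) : A) * E b

/-- The sum over all ways of raising one bead by `m`. -/
def raise (m : ℕ) (E : (Fin N → ℕ) → A) (b : Fin N → ℕ) : A :=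
  ∑ s, E (Function.update b s (b s + m))

/-- The sum over all ways of lowering one bead by `m`. -/
def lower (m : ℕ) (E : (Fin N → ℕ) → A) (b : Fin N → ℕ) : A :=
  ∑ t with m ≤ b t, E (Function.update b t (b t - m))

namespace IsSkew

variable {E : (Fin N → ℕ) → A}

theorem swap (hE : IsSkew E) (b : Fin N → ℕ) {i j : Fin N} (hij : i ≠ j) :
    E (b ∘ Equiv.swap i j) = -E b := by
  rw [hE, Equiv.Perm.sign_swap hij]
  simp

theorem raise (hE : IsSkew E) (m : ℕ) : IsSkew (raise m E) := by
  intro b σ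
  rw [VirasoroSchur.raise, VirasoroSchur.raise, mul_sum,
    ← Equiv.sum_comp σ fun s => _ * E (Function.update b s (b s + m))]
  refine sum_congr rfl fun s _ => ?_
  rw [← hE]
  congr 1
  funext k
  rcases eq_or_ne k s with rfl | hk
  · simp
  · simp [hk]

theorem move {lam mu : YoungDiagram} {n : ℕ} {s : Fin N} {σ : Equiv.Perm (Fin N)} (hE : IsSkew E)
    (h : IsMove lam mu n s σ) (hσ : Equiv.Perm.sign σ = (-1) ^ ht mu lam) :
    E (Function.update (beads N lam) s (beads N lam s + n)) =
      (-1) ^ ht mu lam * E (beads N mu) := by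
  rw [← h, hE, hσ]
  simp

theorem move_sub {lam mu : YoungDiagram} {n : ℕ} {s : Fin N} {σ : Equiv.Perm (Fin N)}
    (hE : IsSkew E) (h : IsMove lam mu n s σ) (hσ : Equiv.Perm.sign σ = (-1) ^ ht mu lam) :
    E (Function.update (beads N mu) (σ s) (beads N mu (σ s) - n)) =
      (-1) ^ ht mu lam * E (beads N lam) := by
  rw [← h.update_sub, hE, hσ, ← mul_assoc]
  push_cast
  rw [← mul_pow]
  simp

variable [IsDomain A] [CharZero A]

theorem eq_zero (hE : IsSkew E) {b : Fin N → ℕ} {i j : Fin N} (hij : i ≠ j) (h : b i = b j) :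
    E b = 0 := by
  have h1 := hE.swap b hij
  have h2 : b ∘ Equiv.swap i j = b := by
    funext k
    rw [Function.comp_apply, Equiv.swap_apply_def]
    split_ifs with h3 h4
    · rw [h3, h]
    · rw [h4, h]
    · rfl
  rw [h2] at h1
  exact self_eq_neg.mp h1

/-- Raising one bead in all possible ways amounts to adding border strips; the raised positions
that collide with another bead contribute nothing. -/
theorem raise_beads (hE : IsSkew E) {lam : YoungDiagram} (hl : lam.colLen 0 ≤ N) {n M : ℕ}
    (hn : 0 < n) (hM : lam.cells.card + n ≤ M) :
    VirasoroSchur.raise n E (beads N lam) =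
      ∑ mu ∈ diagrams M with mu.colLen 0 ≤ N, (stripSign mu lam n : A) * E (beads N mu) := by
  classical
  rw [VirasoroSchur.raise]
  set S : Finset (Fin N) := {s | ∀ i, beads N lam i ≠ beads N lam s + n} with hS
  set F : Finset YoungDiagram :=
    {mu ∈ diagrams M | mu.colLen 0 ≤ N ∧ IsBorderStrip mu lam n} with hF
  have h1 : ∑ s ∈ S, E (Function.update (beads N lam) s (beads N lam s + n)) =
      ∑ s, E (Function.update (beads N lam) s (beads N lam s + n)) := by
    refine sum_subset (subset_univ _) fun s _ hs => ?_
    simp only [hS, mem_filter, mem_univ, true_and, not_forall, not_not] at hs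
    obtain ⟨i, hi⟩ := hs
    have his : i ≠ s := by
      rintro rfl
      omega
    exact hE.eq_zero his (by simp [his, hi])
  have h2 : ∑ mu ∈ F, (stripSign mu lam n : A) * E (beads N mu) =
      ∑ mu ∈ diagrams M with mu.colLen 0 ≤ N, (stripSign mu lam n : A) * E (beads N mu) := by
    rw [hF, ← filter_filter]
    refine sum_filter_of_ne fun mu _ hne => ?_
    by_contra hmu
    exact hne (by rw [stripSign_of_neg hmu]; simp)
  rw [← h1, ← h2]
  symm
  have hF' : ∀ mu ∈ F, mu.colLen 0 ≤ N ∧ IsBorderStrip mu lam n := fun mu hmu =>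
    (mem_filter.mp hmu).2
  choose s σ hs hσ using fun mu (hmu : mu ∈ F) => exists_isMove (hF' mu hmu).2 (hF' mu hmu).1
  refine sum_bij s ?_ ?_ ?_ ?_
  · intro mu hmu
    simpa [hS] using (hs mu hmu).ne_add hn
  · intro mu hmu mu' hmu' h
    have h3 := hs mu' hmu'
    rw [← h] at h3
    exact (hs mu hmu).right_unique h3 (hF' mu hmu).1 (hF' mu' hmu').1
  · intro t ht
    obtain ⟨mu, τ, hmN, hstrip, hmove, -⟩ := exists_isBorderStrip hl hn (mem_filter.mp ht).2
    have hmu : mu ∈ F := by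
      simp only [hF, mem_filter, mem_diagrams]
      exact ⟨hstrip.card_eq.trans_le hM, hmN, hstrip⟩
    exact ⟨mu, hmu, (hs mu hmu).bead_unique hmove hn⟩
  · intro mu hmu
    rw [hE.move (hs mu hmu) (hσ mu hmu), stripSign_of_pos (hF' mu hmu).2]
    simp

/-- Lowering one bead in all possible ways amounts to removing border strips. -/
theorem lower_beads (hE : IsSkew E) {lam : YoungDiagram} (hl : lam.colLen 0 ≤ N) {n M : ℕ}
    (hn : 0 < n) (hM : lam.cells.card ≤ M) :
    VirasoroSchur.lower n E (beads N lam) =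
      ∑ nu ∈ diagrams M, (stripSign lam nu n : A) * E (beads N nu) := by
  classical
  rw [VirasoroSchur.lower]
  set S : Finset (Fin N) :=
    {t | n ≤ beads N lam t ∧ ∀ i, beads N lam i ≠ beads N lam t - n} with hS
  set F : Finset YoungDiagram := {nu ∈ diagrams M | IsBorderStrip lam nu n} with hF
  have h1 : ∑ t ∈ S, E (Function.update (beads N lam) t (beads N lam t - n)) =
      ∑ t with n ≤ beads N lam t,
        E (Function.update (beads N lam) t (beads N lam t - n)) := by
    rw [hS, ← filter_filter]
    refine sum_filter_of_ne fun t ht hne => ?_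
    have hnt := (mem_filter.mp ht).2
    by_contra hs
    push Not at hs
    obtain ⟨i, hi⟩ := hs
    have hit : i ≠ t := by
      rintro rfl
      omega
    exact hne (hE.eq_zero hit (by simp [hit, hi]))
  have h2 : ∑ nu ∈ F, (stripSign lam nu n : A) * E (beads N nu) =
      ∑ nu ∈ diagrams M, (stripSign lam nu n : A) * E (beads N nu) := by
    refine sum_filter_of_ne fun nu _ hne => ?_
    by_contra hnu
    exact hne (by rw [stripSign_of_neg hnu]; simp)
  rw [← h1, ← h2]
  symm
  have hF' : ∀ nu ∈ F, IsBorderStrip lam nu n := fun nu hnu => (mem_filter.mp hnu).2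
  choose s σ hs hσ using fun nu (hnu : nu ∈ F) => exists_isMove (hF' nu hnu) hl
  refine sum_bij (fun nu hnu => σ nu hnu (s nu hnu)) ?_ ?_ ?_ ?_
  · intro nu hnu
    have h3 := (hs nu hnu).apply_self
    simp only [hS, mem_filter, mem_univ, true_and]
    refine ⟨by omega, fun i hi => ?_⟩
    obtain ⟨k, rfl⟩ := (σ nu hnu).surjective i
    rw [h3, Nat.add_sub_cancel] at hi
    rcases eq_or_ne k (s nu hnu) with rfl | hk
    · omega
    · rw [(hs nu hnu).apply_of_ne hk] at hi
      exact hk (strictAnti_beads.injective hi)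
  · intro nu hnu nu' hnu' h
    have h3 := (hs nu hnu).update_sub
    have h4 := (hs nu' hnu').update_sub
    rw [← h] at h4
    refine beads_injective ((colLen_mono (hF' nu hnu).1).trans hl)
      ((colLen_mono (hF' nu' hnu').1).trans hl) ?_
    refine (strictAnti_eq_of_comp_perm_eq strictAnti_beads strictAnti_beads
      (σ := (σ nu hnu)⁻¹) (τ := (σ nu' hnu')⁻¹) ?_).1
    rw [← h3, ← h4]
    funext k
    simp
  · intro t ht
    obtain ⟨-, hnt, ht'⟩ := mem_filter.mp ht
    obtain ⟨nu, s', σ', hstrip, hmove, rfl, -⟩ := exists_isBorderStrip_sub hl hn hnt ht'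
    have hnu : nu ∈ F := by
      simp only [hF, mem_filter, mem_diagrams]
      have := hstrip.card_eq
      exact ⟨by omega, hstrip⟩
    have h3 := (hs nu hnu).bead_unique hmove hn
    have h4 := hs nu hnu
    have h5 : σ nu hnu = σ' := by
      refine (strictAnti_eq_of_comp_perm_eq strictAnti_beads strictAnti_beads
        (f := beads N lam) (g := beads N lam) (h4.trans ?_)).2
      rw [h3]
      exact hmove.symm
    exact ⟨nu, hnu, by simp only [h3, h5]⟩
  · intro nu hnu
    rw [hE.move_sub (hs nu hnu) (hσ nu hnu), stripSign_of_pos (hF' nu hnu)]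
    simp

end IsSkew

end BeadSums

/-! ### Cancellation for moves of two beads -/

section Cancellation

theorem sum_range_eq_of_antisymm {A : Type*} [CommRing A] [IsDomain A] [CharZero A] {G : ℕ → A}
    {S : ℕ} (hG : ∀ x ≤ S, G (S - x) = -G x) {p q : ℕ} (h : p + q = S) :
    ∑ x ∈ range (q + 1), G x = ∑ x ∈ range p, G x := by
  have h0 : ∑ x ∈ range (S + 1), G x = 0 := by
    apply self_eq_neg.mp
    nth_rewrite 1 [← sum_range_reflect]
    rw [← sum_neg_distrib]
    refine sum_congr rfl fun x hx => ?_
    rw [Nat.add_sub_cancel]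
    exact hG x (Nat.lt_succ_iff.mp (mem_range.mp hx))
  rw [← h, add_assoc, sum_range_add, ← sum_range_reflect (fun x => G (p + x))] at h0
  rw [← sub_eq_zero, ← neg_eq_zero, neg_sub, sub_eq_add_neg, ← h0, ← sum_neg_distrib]
  congr 1
  refine sum_congr rfl fun x hx => ?_
  have := mem_range.mp hx
  rw [← hG x (by omega)]
  congr 1
  omega

variable {N : ℕ} {A : Type*} [CommRing A]

/-- The value of `E` after the beads `i ≠ k` have been put at `x` and at the position that makes
the sum of the positions grow by `n`, for `x ≤ b i + b k + n`; it is `0` for `i = k`. -/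
def pairMove (E : (Fin N → ℕ) → A) (n : ℕ) (b : Fin N → ℕ) (i k : Fin N) (x : ℕ) : A :=
  if i = k then 0 else E (Function.update (Function.update b i x) k (b i + b k + n - x))

variable {E : (Fin N → ℕ) → A} (n : ℕ) (b : Fin N → ℕ)

theorem pairMove_comm (hE : IsSkew E) (i k : Fin N) (x : ℕ) :
    pairMove E n b k i x = -pairMove E n b i k x := by
  rw [pairMove, pairMove]
  rcases eq_or_ne i k with rfl | hik
  · simp
  rw [if_neg hik, if_neg hik.symm, ← hE.swap _ hik]
  congr 1
  funext l
  rcases eq_or_ne l i with rfl | hi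
  · simp [add_comm (b l)]
  · rcases eq_or_ne l k with rfl | hk
    · simp [hik, hi]
    · simp [Equiv.swap_apply_of_ne_of_ne, hi, hk]

theorem pairMove_sub (hE : IsSkew E) (i k : Fin N) {x : ℕ} (hx : x ≤ b i + b k + n) :
    pairMove E n b i k (b i + b k + n - x) = -pairMove E n b i k x := by
  rw [← pairMove_comm n b hE, pairMove, pairMove]
  rcases eq_or_ne i k with rfl | hik
  · simp
  rw [if_neg hik, if_neg hik.symm, Function.update_comm hik, add_comm (b k)]
  congr 3
  omega

theorem pairMove_self (h : ∀ i, E (Function.update b i (b i + n)) = 0) (i k : Fin N) :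
    pairMove E n b i k (b i) = 0 := by
  rw [pairMove]
  split_ifs with hik
  · rfl
  · rw [Function.update_eq_self, ← h k]
    congr 2
    omega

theorem pairMove_add (h : ∀ i, E (Function.update b i (b i + n)) = 0) (i k : Fin N) :
    pairMove E n b i k (b i + n) = 0 := by
  rw [pairMove]
  split_ifs with hik
  · rfl
  · rw [← h i]
    congr 1
    have : b i + b k + n - (b i + n) = Function.update b i (b i + n) k := by
      rw [Function.update_of_ne (Ne.symm hik)]
      omega
    rw [this, Function.update_eq_self]

theorem raise_update (h : ∀ i, E (Function.update b i (b i + n)) = 0) (i : Fin N) {x m : ℕ}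
    (hx : x + m = b i + n) :
    raise m E (Function.update b i x) = ∑ k, pairMove E n b i k x := by
  rw [raise]
  refine sum_congr rfl fun k _ => ?_
  rw [pairMove]
  split_ifs with hik
  · subst hik
    rw [Function.update_self, Function.update_idem, hx, h]
  · rw [Function.update_of_ne (Ne.symm hik)]
    congr 2
    omega

/-- Lowering one bead and raising one bead, in all ways that move the configuration up by `n` in
total, together with half of all ways of raising twice, cancel except for the moves of a single
bead by `n`. Here it is shown, after doubling, that nothing remains if these single moves contribute
nothing. For two different beads, the contributions form a sum over an interval of positions of the
one bead, and this sum is antisymmetric under the exchange of the two positions. -/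
theorem two_mul_sum_lower_raise [IsDomain A] [CharZero A] (hE : IsSkew E) (hn : 0 < n)
    (h : ∀ i, E (Function.update b i (b i + n)) = 0) {J : ℕ} (hJ : ∀ i, b i ≤ J) :
    2 * ∑ j ∈ Icc 1 J, lower j (raise (n + j) E) b +
      ∑ r ∈ Ico 1 n, raise r (raise (n - r) E) b = 0 := by
  have h1 : ∑ j ∈ Icc 1 J, lower j (raise (n + j) E) b =
      ∑ i, ∑ k, ∑ x ∈ range (b i), pairMove E n b i k x := by
    simp only [lower, sum_filter]
    rw [sum_comm]
    refine sum_congr rfl fun i _ => ?_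
    rw [← sum_filter, sum_comm]
    refine sum_nbij' (fun j => b i - j) (fun x => b i - x) ?_ ?_ ?_ ?_ ?_
    · intro j hj
      simp only [mem_filter, mem_Icc, mem_range] at hj ⊢
      omega
    · intro x hx
      have := hJ i
      simp only [mem_filter, mem_Icc, mem_range] at hx ⊢
      omega
    · intro j hj
      simp only [mem_filter, mem_Icc] at hj ⊢
      omega
    · intro x hx
      simp only [mem_range] at hx ⊢
      omega
    · intro j hj
      simp only [mem_filter] at hj
      exact raise_update n b h i (by omega)
  have h2 : ∑ r ∈ Ico 1 n, raise r (raise (n - r) E) b =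
      ∑ i, ∑ k, (∑ x ∈ range (b i + n), pairMove E n b i k x -
        ∑ x ∈ range (b i), pairMove E n b i k x) := by
    have h5 : ∀ r ∈ Ico 1 n, raise r (raise (n - r) E) b =
        ∑ i, ∑ k, pairMove E n b i k (b i + r) := by
      intro r hr
      rw [mem_Ico] at hr
      exact sum_congr rfl fun i _ => raise_update n b h i (by omega)
    rw [sum_congr rfl h5, sum_comm]
    refine sum_congr rfl fun i _ => ?_
    rw [sum_comm]
    refine sum_congr rfl fun k _ => ?_
    rw [sum_range_add, add_sub_cancel_left, range_eq_Ico, sum_eq_sum_Ico_succ_bot hn, add_zero,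
      pairMove_self n b h, zero_add]
  have h3 : ∑ i, ∑ k, ∑ x ∈ range (b i), pairMove E n b i k x =
      -∑ i, ∑ k, ∑ x ∈ range (b k), pairMove E n b i k x := by
    rw [sum_comm, ← sum_neg_distrib]
    refine sum_congr rfl fun i _ => ?_
    rw [← sum_neg_distrib]
    refine sum_congr rfl fun k _ => ?_
    rw [← sum_neg_distrib]
    exact sum_congr rfl fun x _ => pairMove_comm n b hE _ _ _
  have h4 : ∑ i, ∑ k, ∑ x ∈ range (b i + n), pairMove E n b i k x =
      ∑ i, ∑ k, ∑ x ∈ range (b k), pairMove E n b i k x := by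
    refine sum_congr rfl fun i _ => sum_congr rfl fun k _ => ?_
    rw [← sum_range_eq_of_antisymm (fun x hx => pairMove_sub n b hE i k hx)
      (show b k + (b i + n) = b i + b k + n by omega), sum_range_succ, pairMove_add n b h, add_zero]
  simp only [sum_sub_distrib] at h2
  rw [h1, h2, h4]
  linear_combination h3

end Cancellation

/-! ### The coefficients -/

section Coefficients

/-- The alternating function that is `1` at the beads of `mu` and vanishes at the beads of all
other partitions. -/
def beadIndicator (N : ℕ) (mu : YoungDiagram) (b : Fin N → ℕ) : ℤ :=
  (Matrix.of fun i j => if b i = beads N mu j then (1 : ℤ) else 0).det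

variable {N : ℕ} {lam mu nu : YoungDiagram}

theorem isSkew_beadIndicator : IsSkew (beadIndicator N mu) := fun b σ =>
  Matrix.det_permute σ (Matrix.of fun i j => if b i = beads N mu j then (1 : ℤ) else 0)

theorem beadIndicator_self : beadIndicator N mu (beads N mu) = 1 := by
  rw [beadIndicator]
  convert! Matrix.det_one (R := ℤ) (n := Fin N)
  ext i j
  simp [Matrix.one_apply, strictAnti_beads.injective.eq_iff]

theorem beadIndicator_of_ne (hn : nu.colLen 0 ≤ N) (hm : mu.colLen 0 ≤ N) (h : nu ≠ mu) :
    beadIndicator N mu (beads N nu) = 0 := by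
  by_contra hdet
  have h1 : ∀ i, ∃ j, beads N mu j = beads N nu i := by
    intro i
    by_contra hi
    push Not at hi
    exact hdet (Matrix.det_eq_zero_of_row_eq_zero i fun j => by simp [(hi j).symm])
  choose f hf using h1
  have hinj : Function.Injective f := fun i j hij =>
    strictAnti_beads.injective ((hf i).symm.trans ((congrArg _ hij).trans (hf j)))
  refine h (beads_injective hn hm (strictAnti_eq_of_comp_perm_eq strictAnti_beads strictAnti_beads
    (σ := 1) (τ := Equiv.ofBijective f (Finite.injective_iff_bijective.mp hinj)) ?_).1)
  funext i
  simp [hf]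

theorem raise_beadIndicator (hn : nu.colLen 0 ≤ N) (hm : mu.colLen 0 ≤ N) {m : ℕ} (h0 : 0 < m) :
    raise m (beadIndicator N mu) (beads N nu) = stripSign mu nu m := by
  classical
  rw [isSkew_beadIndicator.raise_beads hn h0 (le_max_left _ mu.cells.card), sum_eq_single mu]
  · simp [beadIndicator_self]
  · intro mu' hmu' hne
    rw [beadIndicator_of_ne (mem_filter.mp hmu').2 hm hne, mul_zero]
  · intro hmu
    exact absurd (by simp [mem_diagrams, hm]) hmu

/-- The signed number of ways to remove a border strip of some size `1 ≤ j ≤ J` from `lam` and to add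
one of size `n + j`, so as to obtain `mu`, through partitions with at most `M` boxes. -/
def lowerRaiseCount (M J n : ℕ) (lam mu : YoungDiagram) : ℤ :=
  ∑ j ∈ Icc 1 J, ∑ nu ∈ diagrams M, stripSign lam nu j * stripSign mu nu (n + j)

/-- The signed number of ways to add two border strips of total size `n` to `lam`, so as to obtain
`mu`, through partitions with at most `M` boxes. -/
def raiseRaiseCount (M n : ℕ) (lam mu : YoungDiagram) : ℤ :=
  ∑ r ∈ Ico 1 n, ∑ nu ∈ diagrams M, stripSign nu lam r * stripSign mu nu (n - r)

theorem stripSign_eq_zero_of_card {n : ℕ} (h : lam.cells.card < n) : stripSign lam nu n = 0 :=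
  stripSign_of_neg fun hs => by
    have := hs.card_eq
    omega

theorem lowerRaiseCount_of_le {M J J' n : ℕ} (hJ : lam.cells.card ≤ J) (hJ' : J ≤ J') :
    lowerRaiseCount M J' n lam mu = lowerRaiseCount M J n lam mu := by
  symm
  refine sum_subset (Icc_subset_Icc_right hJ') fun j hj hj' => sum_eq_zero fun nu _ => ?_
  rw [mem_Icc] at hj hj'
  rw [stripSign_eq_zero_of_card (by omega), zero_mul]

/-- The pairs of border strips that lead from `lam` to `mu` cancel, with weights `1` and `1 / 2`
doubled here, unless a single border strip leads from `lam` to `mu`. -/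
theorem two_mul_lowerRaiseCount_add {M J n : ℕ} (hn : 0 < n) (hJ : lam.cells.card ≤ J)
    (hM : lam.cells.card + n ≤ M) (h : ¬ IsBorderStrip mu lam n) :
    2 * lowerRaiseCount M J n lam mu + raiseRaiseCount M n lam mu = 0 := by
  classical
  set N := max (lam.colLen 0) (mu.colLen 0)
  have hl : lam.colLen 0 ≤ N := le_max_left _ _
  have hm : mu.colLen 0 ≤ N := le_max_right _ _
  set b := beads N lam with hb
  have hsingle : ∀ i, beadIndicator N mu (Function.update b i (b i + n)) = 0 := by
    intro i
    by_cases hi : ∀ k, b k ≠ b i + n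
    · obtain ⟨mu', σ, hmN, hstrip, hmove, -⟩ := exists_isBorderStrip hl hn hi
      rw [← hmove, isSkew_beadIndicator, beadIndicator_of_ne hmN hm, mul_zero]
      rintro rfl
      exact h hstrip
    · push Not at hi
      obtain ⟨k, hk⟩ := hi
      have hki : k ≠ i := by
        rintro rfl
        omega
      exact isSkew_beadIndicator.eq_zero hki (by simp [hki, hk])
  have key := two_mul_sum_lower_raise n b isSkew_beadIndicator hn hsingle
    (J := max J (∑ i, b i)) fun i => le_max_of_le_right (single_le_sum (fun _ _ => Nat.zero_le _)
      (mem_univ i))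
  rw [← lowerRaiseCount_of_le hJ (le_max_left J (∑ i, b i)), ← key]
  congr 1
  · congr 1
    refine sum_congr rfl fun j hj => ?_
    rw [mem_Icc] at hj
    rw [hb, (isSkew_beadIndicator.raise (n + j)).lower_beads hl hj.1 (by omega : _ ≤ M)]
    refine sum_congr rfl fun nu _ => ?_
    by_cases hs : IsBorderStrip lam nu j
    · rw [raise_beadIndicator ((colLen_mono hs.1).trans hl) hm (by omega), Int.cast_id]
    · rw [stripSign_of_neg hs]
      simp
  · refine sum_congr rfl fun r hr => ?_
    rw [mem_Ico] at hr
    rw [hb, (isSkew_beadIndicator.raise (n - r)).raise_beads hl hr.1 (by omega : _ ≤ M),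
      sum_filter]
    refine sum_congr rfl fun nu _ => ?_
    split_ifs with hnu
    · rw [raise_beadIndicator hnu hm (by omega), Int.cast_id]
    · rw [stripSign_of_neg (lam := nu), mul_zero]
      exact fun hs => hnu ((colLen_mono hs.1).trans hm)

theorem finsum_mem_eq_sum_of_eq {ι A : Type*} [AddCommMonoid A] {S : Set ι} {Y : Finset ι}
    {f g : ι → A} (hS : ∀ x ∈ S, x ∈ Y) (hf : ∀ x ∈ S, f x = g x) (hg : ∀ x ∈ Y, x ∉ S → g x = 0) :
    ∑ᶠ x ∈ S, f x = ∑ x ∈ Y, g x := by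
  rw [finsum_mem_congr rfl hf]
  refine finsum_mem_eq_sum_of_inter_support_eq g ?_
  ext x
  simp only [Set.mem_inter_iff, Function.mem_support, mem_coe]
  constructor
  · rintro ⟨h1, h2⟩
    exact ⟨hS x h1, h2⟩
  · rintro ⟨hY, h2⟩
    exact ⟨by_contra fun h1 => h2 (hg x hY h1), h2⟩

theorem cast_stripSign_mul {A : Type*} [CommRing A] {a b c d : YoungDiagram} {m n : ℕ}
    (h : IsBorderStrip a b m) (h' : IsBorderStrip c d n) :
    ((stripSign a b m * stripSign c d n : ℤ) : A) = (-1) ^ (ht a b + ht c d) := by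
  rw [stripSign_of_pos h, stripSign_of_pos h', ← pow_add]
  push_cast
  rfl

theorem virasoroCoeff_eq {M J n : ℕ} (hJ : lam.cells.card ≤ J) (hM : lam.cells.card + n ≤ M)
    (hn : 0 < n) (h : IsBorderStrip mu lam n) :
    virasoroCoeff n lam mu =
      (lowerRaiseCount M J n lam mu : ℚ) + 1 / 2 * (raiseRaiseCount M n lam mu : ℚ) := by
  rw [virasoroCoeff, lowerRaiseCount, raiseRaiseCount]
  congr 1
  · have hsub : ∀ nu, skewCells lam nu ⊆ skewCells mu nu := fun nu =>
      sdiff_subset_sdiff (YoungDiagram.cells_subset_iff.mpr h.1) Subset.rfl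
    rw [← lowerRaiseCount, lowerRaiseCount]
    have h1 : ∀ i, ∑ᶠ nu ∈ {nu : YoungDiagram | IsBorderStrip lam nu i ∧
        IsBorderStrip mu nu (n + i) ∧ skewCells lam nu ⊆ skewCells mu nu},
          (-1 : ℚ) ^ (ht lam nu + ht mu nu) =
        ((∑ nu ∈ diagrams M, stripSign lam nu i * stripSign mu nu (n + i) : ℤ) : ℚ) := by
      intro i
      rw [Int.cast_sum]
      refine finsum_mem_eq_sum_of_eq ?_ ?_ ?_
      · rintro nu ⟨h2, -, -⟩
        rw [mem_diagrams]
        have := h2.card_eq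
        omega
      · rintro nu ⟨h2, h3, -⟩
        exact (cast_stripSign_mul h2 h3).symm
      · intro nu _ hnu
        by_cases h2 : IsBorderStrip lam nu i
        · rw [stripSign_of_neg (mu := mu) fun h3 => hnu ⟨h2, h3, hsub nu⟩]
          simp
        · rw [stripSign_of_neg h2]
          simp
    simp only [h1]
    rw [Int.cast_sum]
    refine finsum_mem_eq_sum_of_inter_support_eq _ ?_
    ext i
    simp only [Set.mem_inter_iff, Set.mem_ofPred_eq, Function.mem_support, coe_Icc, Set.mem_Icc,
      and_congr_left_iff]
    intro hne
    refine ⟨fun h2 => ⟨h2, ?_⟩, fun h2 => h2.1⟩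
    by_contra h3
    refine hne ?_
    rw [sum_eq_zero, Int.cast_zero]
    intro nu _
    rw [stripSign_eq_zero_of_card (by omega), zero_mul]
  · have h1 : ∀ i ∈ Icc 1 n, ∑ᶠ nu ∈ {nu : YoungDiagram | IsBorderStrip nu lam i ∧
        IsBorderStrip mu nu (n - i)}, (-1 : ℚ) ^ (ht nu lam + ht mu nu) =
        ((∑ nu ∈ diagrams M, stripSign nu lam i * stripSign mu nu (n - i) : ℤ) : ℚ) := by
      intro i hi
      rw [mem_Icc] at hi
      rw [Int.cast_sum]
      refine finsum_mem_eq_sum_of_eq ?_ ?_ ?_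
      · rintro nu ⟨h2, -⟩
        rw [mem_diagrams]
        have := h2.card_eq
        omega
      · rintro nu ⟨h2, h3⟩
        exact (cast_stripSign_mul h2 h3).symm
      · intro nu _ hnu
        by_cases h2 : IsBorderStrip nu lam i
        · rw [stripSign_of_neg (mu := mu) fun h3 => hnu ⟨h2, h3⟩]
          simp
        · rw [stripSign_of_neg h2]
          simp
    rw [sum_congr rfl h1, ← Ico_insert_right hn, sum_insert (by simp)]
    -- the term `i = n` vanishes, as there are no border strips of size `0`
    rw [sum_eq_zero, Int.cast_zero, zero_add, Int.cast_sum]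
    intro nu _
    rw [Nat.sub_self, stripSign_of_neg (mu := mu) fun h => h.pos.ne rfl, mul_zero]

end Coefficients

/-! ### The operators -/

section Operators

variable {K : Type*} [Field K] [CharZero K]

theorem isSkew_beadDet (N : ℕ) : IsSkew (beadDet K N) := beadDet_comp_perm

/-- The Murnaghan–Nakayama rule. -/
theorem powerSum_mul_schur_eq_sum (n : ℕ) (hn : 0 < n) {lam : YoungDiagram} {M : ℕ}
    (hM : lam.cells.card + n ≤ M) :
    powerSum K n * schur K lam =
      ∑ mu ∈ diagrams M, (stripSign mu lam n : K) • schur K mu := by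
  classical
  -- enough beads for all partitions with at most `M` boxes and for the multiplication rule
  set N := (∑ mu ∈ diagrams M, mu.colLen 0) + lam.colLen 0 + n with hN
  have hcol : ∀ mu ∈ diagrams M, mu.colLen 0 ≤ N := fun mu hmu => by
    have := single_le_sum (f := fun mu : YoungDiagram => mu.colLen 0) (fun _ _ => Nat.zero_le _) hmu
    omega
  have h1 := powerSum_mul_schur (K := K) (N := N) (lam := lam) ⟨n, hn⟩
    (by simp only [PNat.mk_coe]; omega)
  simp only [PNat.mk_coe] at h1
  rw [h1]
  have h2 := (isSkew_beadDet (K := K) N).raise_beads (lam := lam) (by omega) hn hM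
  rw [raise] at h2
  rw [h2, filter_true_of_mem hcol]
  refine sum_congr rfl fun mu hmu => ?_
  rw [beadDet_beads (hcol mu hmu), MvPolynomial.smul_eq_C_mul, map_intCast]

/-- The adjoint of the Murnaghan–Nakayama rule. -/
theorem pderiv_schur_eq_sum (n : ℕ+) {lam : YoungDiagram} {M : ℕ} (hM : lam.cells.card ≤ M) :
    MvPolynomial.pderiv n (schur K lam) =
      ∑ nu ∈ diagrams M, (stripSign lam nu n : K) • schur K nu := by
  rw [pderiv_schur n le_rfl]
  have h2 := (isSkew_beadDet (K := K) (lam.colLen 0)).lower_beads le_rfl n.pos hM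
  rw [lower] at h2
  rw [h2]
  refine sum_congr rfl fun nu _ => ?_
  rw [MvPolynomial.smul_eq_C_mul, map_intCast]
  by_cases h : IsBorderStrip lam nu n
  · rw [beadDet_beads (colLen_mono h.1)]
  · rw [stripSign_of_neg h]
    simp

theorem pderiv_schur_eq_zero {n : ℕ+} {lam : YoungDiagram} (h : lam.cells.card < n) :
    MvPolynomial.pderiv n (schur K lam) = 0 := by
  rw [pderiv_schur_eq_sum n le_rfl]
  refine sum_eq_zero fun nu _ => ?_
  rw [stripSign_eq_zero_of_card h]
  simp

theorem smul_X_eq_powerSum {F : Type*} [Field F] (i : ℕ+) :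
    ((i : ℕ) : F) • (MvPolynomial.X i : TPoly F) = powerSum F i := by
  simp [powerSum]

theorem finsum_mem_eq_sum_comp {ι κ A : Type*} [AddCommMonoid A] {S : Set κ} {T : Finset ι}
    {F : κ → A} (e : ι → κ) (he : ∀ r ∈ T, e r ∈ S) (hinj : Set.InjOn e T)
    (hsurj : ∀ p ∈ S, F p ≠ 0 → ∃ r ∈ T, e r = p) :
    ∑ᶠ p ∈ S, F p = ∑ r ∈ T, F (e r) := by
  classical
  rw [← sum_image hinj]
  refine finsum_mem_eq_sum_of_inter_support_eq F ?_
  ext p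
  simp only [Set.mem_inter_iff, Function.mem_support, coe_image, Set.mem_image, mem_coe]
  constructor
  · rintro ⟨h1, h2⟩
    exact ⟨hsurj p h1 h2, h2⟩
  · rintro ⟨⟨r, hr, rfl⟩, h2⟩
    exact ⟨he r hr, h2⟩

theorem finsum_mem_empty_of_forall {ι A : Type*} [AddCommMonoid A] {S : Set ι} {F : ι → A}
    (h : ∀ p, p ∉ S) : ∑ᶠ p ∈ S, F p = 0 := by
  rw [Set.eq_empty_of_forall_notMem h, finsum_mem_empty]

/-- `V_{-n}` as a finite sum, on a polynomial in which no variable beyond `t_J` occurs. -/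
theorem virasoro_neg {F : Type*} [Field F] {n : ℕ} (hn : 0 < n)
    {f : TPoly F} {J : ℕ} (hJ : ∀ j : ℕ+, J < j → MvPolynomial.pderiv j f = 0) :
    virasoro (-(n : ℤ)) f =
      ∑ j ∈ Icc 1 J, powerSum F (n + j) * MvPolynomial.pderiv j.toPNat' f +
        (1 / 2 : F) • ∑ r ∈ Ico 1 n, powerSum F (n - r) * (powerSum F r * f) := by
  rw [virasoro, finsum_mem_empty_of_forall, smul_zero, zero_add]
  · simp only [smul_X_eq_powerSum]
    congr 1
    · rw [finsum_mem_eq_sum_comp (T := Icc 1 J) (fun j => ((n + j).toPNat', j.toPNat'))]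
      · refine sum_congr rfl fun j hj => ?_
        rw [mem_Icc] at hj
        simp only
        congr 2
        rw [Nat.toPNat'_coe, if_pos (by omega)]
      · intro j hj
        rw [mem_Icc] at hj
        rw [Set.mem_ofPred_eq, Nat.toPNat'_coe, if_pos (by omega), Nat.toPNat'_coe,
          if_pos (by omega)]
        push_cast
        ring
      · intro i hi j hj hij
        rw [mem_coe, mem_Icc] at hi hj
        have := congrArg (fun p : ℕ+ × ℕ+ => (p.2 : ℕ)) hij
        simp only [Nat.toPNat'_coe] at this
        rwa [if_pos (by omega), if_pos (by omega)] at this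
      · rintro ⟨i, j⟩ hij hne
        rw [Set.mem_ofPred_eq] at hij
        simp only at hij hne
        have := j.pos
        refine ⟨j, mem_Icc.mpr ⟨j.pos, ?_⟩, ?_⟩
        · by_contra hlt
          exact hne (by rw [hJ j (by omega), mul_zero])
        · have h1 : n + (j : ℕ) = i := by omega
          rw [h1, PNat.coe_toPNat', PNat.coe_toPNat']
    · congr 1
      rw [finsum_mem_eq_sum_comp (T := Ico 1 n) (fun r => ((n - r).toPNat', r.toPNat'))]
      · refine sum_congr rfl fun r hr => ?_
        rw [mem_Ico] at hr
        simp only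
        rw [Nat.toPNat'_coe, if_pos (by omega), Nat.toPNat'_coe, if_pos (by omega)]
      · intro r hr
        rw [mem_Ico] at hr
        rw [Set.mem_ofPred_eq, Nat.toPNat'_coe, if_pos (by omega), Nat.toPNat'_coe,
          if_pos (by omega)]
        omega
      · intro i hi j hj hij
        rw [mem_coe, mem_Ico] at hi hj
        have := congrArg (fun p : ℕ+ × ℕ+ => (p.2 : ℕ)) hij
        simp only [Nat.toPNat'_coe] at this
        rwa [if_pos (by omega), if_pos (by omega)] at this
      · rintro ⟨i, j⟩ hij -
        rw [Set.mem_ofPred_eq] at hij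
        simp only at hij
        have := i.pos
        have := j.pos
        refine ⟨j, mem_Ico.mpr ⟨j.pos, by omega⟩, ?_⟩
        have h1 : n - (j : ℕ) = i := by omega
        rw [h1, PNat.coe_toPNat', PNat.coe_toPNat']
  · rintro ⟨i, j⟩ hij
    rw [Set.mem_ofPred_eq] at hij
    have := i.pos
    simp only at hij
    omega

/-- `V_n` as a finite sum, on a polynomial in which no variable beyond `t_J` occurs. -/
theorem virasoro_pos {F : Type*} [Field F] {n : ℕ} (hn : 0 < n)
    {f : TPoly F} {J : ℕ} (hJ : ∀ j : ℕ+, J < j → MvPolynomial.pderiv j f = 0) :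
    virasoro (n : ℤ) f =
      ∑ j ∈ Icc 1 J, powerSum F j * MvPolynomial.pderiv (n + j).toPNat' f +
        (1 / 2 : F) • ∑ r ∈ Ico 1 n,
          MvPolynomial.pderiv r.toPNat' (MvPolynomial.pderiv (n - r).toPNat' f) := by
  rw [virasoro, finsum_mem_empty_of_forall (S := {p : ℕ+ × ℕ+ | -_ - _ = _}), smul_zero, add_zero,
    add_comm]
  · simp only [smul_X_eq_powerSum]
    congr 1
    · rw [finsum_mem_eq_sum_comp (T := Icc 1 J) (fun j => (j.toPNat', (n + j).toPNat'))]
      · refine sum_congr rfl fun j hj => ?_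
        rw [mem_Icc] at hj
        simp only
        congr 2
        rw [Nat.toPNat'_coe, if_pos (by omega)]
      · intro j hj
        rw [mem_Icc] at hj
        rw [Set.mem_ofPred_eq, Nat.toPNat'_coe, if_pos (by omega), Nat.toPNat'_coe,
          if_pos (by omega)]
        push_cast
        ring
      · intro i hi j hj hij
        rw [mem_coe, mem_Icc] at hi hj
        have := congrArg (fun p : ℕ+ × ℕ+ => (p.1 : ℕ)) hij
        simp only [Nat.toPNat'_coe] at this
        rwa [if_pos (by omega), if_pos (by omega)] at this
      · rintro ⟨j, i⟩ hij hne
        rw [Set.mem_ofPred_eq] at hij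
        simp only at hij hne
        have := j.pos
        refine ⟨j, mem_Icc.mpr ⟨j.pos, ?_⟩, ?_⟩
        · by_contra hlt
          exact hne (by rw [hJ i (by omega), mul_zero])
        · have h1 : n + (j : ℕ) = i := by omega
          rw [h1, PNat.coe_toPNat', PNat.coe_toPNat']
    · congr 1
      rw [finsum_mem_eq_sum_comp (T := Ico 1 n) (fun r => (r.toPNat', (n - r).toPNat'))]
      · intro r hr
        rw [mem_Ico] at hr
        rw [Set.mem_ofPred_eq, Nat.toPNat'_coe, if_pos (by omega), Nat.toPNat'_coe,
          if_pos (by omega)]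
        omega
      · intro i hi j hj hij
        rw [mem_coe, mem_Ico] at hi hj
        have := congrArg (fun p : ℕ+ × ℕ+ => (p.1 : ℕ)) hij
        simp only [Nat.toPNat'_coe] at this
        rwa [if_pos (by omega), if_pos (by omega)] at this
      · rintro ⟨j, i⟩ hij -
        rw [Set.mem_ofPred_eq] at hij
        simp only at hij
        have := i.pos
        have := j.pos
        refine ⟨j, mem_Ico.mpr ⟨j.pos, by omega⟩, ?_⟩
        have h1 : n - (j : ℕ) = i := by omega
        rw [h1, PNat.coe_toPNat', PNat.coe_toPNat']
  · rintro ⟨i, j⟩ hij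
    rw [Set.mem_ofPred_eq] at hij
    have := i.pos
    simp only at hij
    omega

/-- The expansion of `T g` in Schur polynomials, from the expansion of `g` and those of the `T s_nu`
for the `nu` that occur in it. -/
theorem sum_smul_comp {Y Y' : Finset YoungDiagram} {g : TPoly K} (T : TPoly K →ₗ[K] TPoly K)
    {a : YoungDiagram → ℤ} {c : YoungDiagram → YoungDiagram → ℤ}
    (hg : g = ∑ nu ∈ Y, (a nu : K) • schur K nu)
    (hT : ∀ nu, a nu ≠ 0 → T (schur K nu) = ∑ mu ∈ Y', (c mu nu : K) • schur K mu) :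
    T g = ∑ mu ∈ Y', ((∑ nu ∈ Y, a nu * c mu nu : ℤ) : K) • schur K mu := by
  rw [hg, map_sum]
  simp only [Int.cast_sum, sum_smul]
  rw [sum_comm]
  refine sum_congr rfl fun nu _ => ?_
  rw [map_smul]
  by_cases h : a nu = 0
  · simp [h]
  · rw [hT nu h, smul_sum]
    refine sum_congr rfl fun mu _ => ?_
    rw [smul_smul]
    push_cast
    rfl

theorem isBorderStrip_of_stripSign {lam mu : YoungDiagram} {n : ℕ} (h : stripSign mu lam n ≠ 0) :
    IsBorderStrip mu lam n := by
  by_contra hs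
  exact h (stripSign_of_neg hs)

theorem sum_sum_smul {ι : Type*} {T : Finset ι} {Y : Finset YoungDiagram}
    (c : ι → YoungDiagram → ℤ) :
    ∑ j ∈ T, ∑ mu ∈ Y, (c j mu : K) • schur K mu =
      ∑ mu ∈ Y, ((∑ j ∈ T, c j mu : ℤ) : K) • schur K mu := by
  rw [sum_comm]
  simp only [Int.cast_sum, sum_smul]

theorem virasoro_neg_schur {n : ℕ} (hn : 0 < n) {lam : YoungDiagram} {M : ℕ}
    (hM : lam.cells.card + n ≤ M) :
    virasoro (-(n : ℤ)) (schur K lam) = ∑ mu ∈ diagrams M,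
      ((lowerRaiseCount M lam.cells.card n lam mu : K) +
        1 / 2 * (raiseRaiseCount M n lam mu : K)) • schur K mu := by
  rw [virasoro_neg hn (J := lam.cells.card) fun j hj => pderiv_schur_eq_zero hj]
  have h1 : ∀ j ∈ Icc 1 lam.cells.card,
      powerSum K (n + j) * MvPolynomial.pderiv j.toPNat' (schur K lam) =
        ∑ mu ∈ diagrams M, ((∑ nu ∈ diagrams M,
          stripSign lam nu j * stripSign mu nu (n + j) : ℤ) : K) • schur K mu := by
    intro j hj
    rw [mem_Icc] at hj
    have e : ((j.toPNat' : ℕ+) : ℕ) = j := by rw [Nat.toPNat'_coe, if_pos (by omega)]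
    have h := pderiv_schur_eq_sum (K := K) j.toPNat' (by omega : lam.cells.card ≤ M)
    rw [e] at h
    refine sum_smul_comp (LinearMap.mulLeft K (powerSum K (n + j)))
      (c := fun mu nu => stripSign mu nu (n + j)) h fun nu hnu => ?_
    have := (isBorderStrip_of_stripSign hnu).card_eq
    exact powerSum_mul_schur_eq_sum (n + j) (by omega) (by omega)
  have h2 : ∀ r ∈ Ico 1 n, powerSum K (n - r) * (powerSum K r * schur K lam) =
      ∑ mu ∈ diagrams M, ((∑ nu ∈ diagrams M,
        stripSign nu lam r * stripSign mu nu (n - r) : ℤ) : K) • schur K mu := by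
    intro r hr
    rw [mem_Ico] at hr
    refine sum_smul_comp (LinearMap.mulLeft K (powerSum K (n - r)))
      (c := fun mu nu => stripSign mu nu (n - r))
      (powerSum_mul_schur_eq_sum r (by omega) (by omega)) fun nu hnu => ?_
    have := (isBorderStrip_of_stripSign hnu).card_eq
    exact powerSum_mul_schur_eq_sum (n - r) (by omega) (by omega)
  rw [sum_congr rfl h1, sum_congr rfl h2, sum_sum_smul, sum_sum_smul, smul_sum, ← sum_add_distrib]
  refine sum_congr rfl fun mu _ => ?_
  rw [smul_smul, ← add_smul]
  rfl

theorem virasoro_pos_schur {n : ℕ} (hn : 0 < n) {lam : YoungDiagram} {M : ℕ}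
    (hM : lam.cells.card ≤ M) :
    virasoro (n : ℤ) (schur K lam) = ∑ mu ∈ diagrams lam.cells.card,
      ((lowerRaiseCount M lam.cells.card n mu lam : K) +
        1 / 2 * (raiseRaiseCount M n mu lam : K)) • schur K mu := by
  rw [virasoro_pos hn (J := lam.cells.card) fun j hj => pderiv_schur_eq_zero hj]
  have h1 : ∀ j ∈ Icc 1 lam.cells.card,
      powerSum K j * MvPolynomial.pderiv (n + j).toPNat' (schur K lam) =
        ∑ mu ∈ diagrams lam.cells.card, ((∑ nu ∈ diagrams M,
          stripSign lam nu (n + j) * stripSign mu nu j : ℤ) : K) • schur K mu := by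
    intro j hj
    rw [mem_Icc] at hj
    have e : (((n + j).toPNat' : ℕ+) : ℕ) = n + j := by rw [Nat.toPNat'_coe, if_pos (by omega)]
    have h := pderiv_schur_eq_sum (K := K) (n + j).toPNat' hM
    rw [e] at h
    refine sum_smul_comp (LinearMap.mulLeft K (powerSum K j))
      (c := fun mu nu => stripSign mu nu j) h fun nu hnu => ?_
    have := (isBorderStrip_of_stripSign hnu).card_eq
    exact powerSum_mul_schur_eq_sum j (by omega) (by omega)
  have h2 : ∀ r ∈ Ico 1 n, MvPolynomial.pderiv r.toPNat'
        (MvPolynomial.pderiv (n - r).toPNat' (schur K lam)) =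
      ∑ mu ∈ diagrams lam.cells.card, ((∑ nu ∈ diagrams M,
        stripSign lam nu (n - r) * stripSign nu mu r : ℤ) : K) • schur K mu := by
    intro r hr
    rw [mem_Ico] at hr
    have e : ((r.toPNat' : ℕ+) : ℕ) = r := by rw [Nat.toPNat'_coe, if_pos (by omega)]
    have e' : (((n - r).toPNat' : ℕ+) : ℕ) = n - r := by rw [Nat.toPNat'_coe, if_pos (by omega)]
    have h := pderiv_schur_eq_sum (K := K) (n - r).toPNat' hM
    rw [e'] at h
    refine sum_smul_comp (MvPolynomial.pderiv r.toPNat' : Derivation K (TPoly K) (TPoly K))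
      (c := fun mu nu => stripSign nu mu r) h fun nu hnu => ?_
    have h3 := (isBorderStrip_of_stripSign hnu).card_eq
    have h4 := pderiv_schur_eq_sum (K := K) r.toPNat' (by omega : nu.cells.card ≤ lam.cells.card)
    rw [e] at h4
    exact h4
  rw [sum_congr rfl h1, sum_congr rfl h2, sum_sum_smul, sum_sum_smul, smul_sum, ← sum_add_distrib]
  refine sum_congr rfl fun mu _ => ?_
  rw [smul_smul, ← add_smul, lowerRaiseCount, raiseRaiseCount]
  simp only [mul_comm]

theorem cast_virasoroCoeff_eq {M J n : ℕ} {lam mu : YoungDiagram} (hn : 0 < n) (hJ : lam.cells.card ≤ J)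
    (hM : lam.cells.card + n ≤ M) (h : IsBorderStrip mu lam n) :
    (virasoroCoeff n lam mu : K) =
      (lowerRaiseCount M J n lam mu : K) + 1 / 2 * (raiseRaiseCount M n lam mu : K) := by
  rw [virasoroCoeff_eq hJ hM hn h]
  push_cast
  rfl

theorem lowerRaiseCount_add_eq_zero {M J n : ℕ} {lam mu : YoungDiagram} (hn : 0 < n) (hJ : lam.cells.card ≤ J)
    (hM : lam.cells.card + n ≤ M) (h : ¬ IsBorderStrip mu lam n) :
    (lowerRaiseCount M J n lam mu : K) + 1 / 2 * (raiseRaiseCount M n lam mu : K) = 0 := by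
  have h1 := congrArg (fun x : ℤ => (x : K)) (two_mul_lowerRaiseCount_add hn hJ hM h)
  push_cast at h1
  linear_combination (1 / 2 : K) * h1

end Operators

end VirasoroSchur
end

open VirasoroSchur in
theorem theorem5p1 {K : Type*} [Field K] [CharZero K] (n : ℕ+) (lam : YoungDiagram) :
    -- the two index sets of partitions are finite
    {mu : YoungDiagram | IsBorderStrip mu lam n}.Finite ∧
    {mu : YoungDiagram | IsBorderStrip lam mu n}.Finite ∧
    -- the action of the Virasoro operators
    virasoro (-((n : ℕ) : ℤ)) (schur K lam) =
      ∑ᶠ mu ∈ {mu : YoungDiagram | IsBorderStrip mu lam n},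
        (virasoroCoeff n lam mu : K) • schur K mu ∧
    virasoro ((n : ℕ) : ℤ) (schur K lam) =
      ∑ᶠ mu ∈ {mu : YoungDiagram | IsBorderStrip lam mu n},
        (virasoroCoeff n mu lam : K) • schur K mu ∧
    -- the same bands occur for multiplication by `n t_n` and for `∂/∂t_n`
    (((n : ℕ) : K) • (MvPolynomial.X n : TPoly K)) * schur K lam =
      ∑ᶠ mu ∈ {mu : YoungDiagram | IsBorderStrip mu lam n},
        ((-1 : K) ^ ht mu lam) • schur K mu ∧
    MvPolynomial.pderiv n (schur K lam) =
      ∑ᶠ mu ∈ {mu : YoungDiagram | IsBorderStrip lam mu n},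
        ((-1 : K) ^ ht lam mu) • schur K mu := by
  set M := lam.cells.card + n with hM
  have hup : ∀ mu ∈ {mu : YoungDiagram | IsBorderStrip mu lam n}, mu ∈ diagrams M := fun mu h =>
    mem_diagrams.mpr h.card_eq.le
  have hdown : ∀ mu ∈ {mu : YoungDiagram | IsBorderStrip lam mu n},
      mu ∈ diagrams lam.cells.card := fun mu h =>
    mem_diagrams.mpr (by have := h.card_eq; omega)
  refine ⟨(diagrams M).finite_toSet.subset hup, (diagrams lam.cells.card).finite_toSet.subset hdown,
    ?_, ?_, ?_, ?_⟩
  · rw [virasoro_neg_schur n.pos le_rfl]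
    refine (finsum_mem_eq_sum_of_eq hup (fun mu h => ?_) fun mu hmu h => ?_).symm
    · rw [cast_virasoroCoeff_eq n.pos le_rfl le_rfl h]
    · rw [lowerRaiseCount_add_eq_zero n.pos le_rfl le_rfl h, zero_smul]
  · rw [virasoro_pos_schur n.pos (by omega : _ ≤ M)]
    refine (finsum_mem_eq_sum_of_eq hdown (fun mu h => ?_) fun mu hmu h => ?_).symm
    · have := h.card_eq
      rw [cast_virasoroCoeff_eq n.pos (by omega : _ ≤ lam.cells.card) (by omega : _ ≤ M) h]
    · rw [mem_diagrams] at hmu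
      rw [lowerRaiseCount_add_eq_zero n.pos hmu (by omega : _ ≤ M) h, zero_smul]
  · rw [smul_X_eq_powerSum, powerSum_mul_schur_eq_sum n n.pos le_rfl]
    refine (finsum_mem_eq_sum_of_eq hup (fun mu h => ?_) fun mu hmu h => ?_).symm
    · rw [stripSign_of_pos h]
      push_cast
      rfl
    · rw [stripSign_of_neg h, Int.cast_zero, zero_smul]
  · rw [pderiv_schur_eq_sum n le_rfl]
    refine (finsum_mem_eq_sum_of_eq hdown (fun mu h => ?_) fun mu hmu h => ?_).symm
    · rw [stripSign_of_pos h]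
      push_cast
      rfl
    · rw [stripSign_of_neg h, Int.cast_zero, zero_smul]
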